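/- Let $M$ be a smooth (Hausdorff, finite-dimensional) manifold and let $\eta\in\Omega^3(M)$ be a closed $3$-form. Let $\mathbb{T}M=TM\oplus T^*M$ carry the pairing $\langle v_1\oplus\alpha_1,v_2\oplus\alpha_2\rangle=\alpha_1(v_2)+\alpha_2(v_1)$, and let a section $w=v\oplus\alpha$ of $\mathbb{T}M$ act on differential forms by $\rho(w)\phi=\iota(v)\phi+\alpha\wedge\phi$. For $w_1,w_2\in\Gamma(\mathbb{T}M)$ the Courant bracket $[\![w_1,w_2]\!]$ relative to $\eta$ is the section of $\mathbb{T}M$ determined by $$\rho([\![w_1,w_2]\!])=[\rho(w_1),[\rho(w_2),\mathrm{d}+\eta]]$$ as operators on $\Omega(M)$ (graded commutators, $\eta$ acting by exterior multiplication). Let $E\subset\mathbb{T}M$ be an almost Dirac structure, i.e. a smooth subbundle with $E=E^\perp$. For an open set $U\subset M$ let $\Omega^{(k)}(U)$ be the space of forms $\gamma\in\Omega(U)$ with $\rho(w_0)\cdots\rho(w_k)\gamma=0$ for all $w_0,\dots,w_k\in\Gamma(E|_U)$. One says that $E$ is integrable relative to $\eta$ if for every open $U\subset M$ and every nowhere vanishing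 form $\phi\in\Omega(U)$ with null space $N_\phi=\{w : \rho(w)\phi=0\}$ equal to $E$ at every point of $U$ (a pure spinor defining $E|_U$), the class of $(\mathrm{d}+\eta)\phi$ in $\Omega^{(3)}(U)/\Omega^{(2)}(U)$ is zero, i.e. $(\mathrm{d}+\eta)\phi\in\Omega^{(2)}(U)$. Then: 1. The Courant bracket is well defined: for all $w_1,w_2\in\Gamma(\mathbb{T}M)$ there is exactly one section $[\![w_1,w_2]\!]\in\Gamma(\mathbb{T}M)$ as above. 2. $E$ is integrable relative to $\eta$ if and only if $\Gamma(E)$ is closed under the Courant bracket. 3. In this case the restriction $[\cdot,\cdot]_E$ of the Courant bracket to $\Gamma(E)$ makes $E$ a Lie algebroid with anchor the projection to $TM$: $[\cdot,\cdot]_E$ is a Lie bracket ($\mathbb{R}$-bilinear, alternating, satisfying the Jacobi identity) on $\Gamma(E)$, the projection $a\colon\Gamma(E)\to\mathfrak{X}(M)$ satisfies $a([w_1,w_2]_E)=[a(w_1),a(w_2)]$, and $$[w_1,fw_2]_E=f\,[w_1,w_2]_E+(a(w_1)f)\,w_2\qquad\text{for all } w_1,w_2\in\Gamma(E),\ f\in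 C^\infty(M).$$ -/

import Mathlib

open scoped Manifold ContDiff Topology
open Bundle

/-! ### Linear algebra: the space `V ⊕ V*` and its spinor module `⋀ V*` -/

section LinearAlgebra

/-- The symmetric pairing `⟨v₁ ⊕ α₁, v₂ ⊕ α₂⟩ = α₁(v₂) + α₂(v₁)` on `W ⊕ W*`. -/
def diracPairing {W : Type*} [AddCommGroup W] [Module ℝ W] [TopologicalSpace W]
    (w₁ w₂ : W × (W →L[ℝ] ℝ)) : ℝ :=
  w₁.2 w₂.1 + w₂.2 w₁.1

/-- A subspace `L` of `W ⊕ W*` is Lagrangian if it equals its own orthogonal space. -/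
def IsLagrangian {W : Type*} [AddCommGroup W] [Module ℝ W] [TopologicalSpace W]
    [IsTopologicalAddGroup W] [ContinuousSMul ℝ W]
    (L : Submodule ℝ (W × (W →L[ℝ] ℝ))) : Prop :=
  ∀ w, w ∈ L ↔ ∀ w' ∈ L, diracPairing w w' = 0

variable {V : Type*} [NormedAddCommGroup V] [NormedSpace ℝ V]

/-- The wedge product `a ∧ b` of a `p`-form `a` and a `q`-form `b` on `V`, normalised by
`(e¹ ∧ ⋯ ∧ eᵖ)(e₁, …, eₚ) = 1` for dual bases. It is defined by recursion on `p`: the product with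
a `0`-form is multiplication by a scalar, and
`(p + 1) • (a ∧ b) = ∑ i, eⁱ ∧ (ι_{e_i} a) ∧ b` for a `(p + 1)`-form `a`
(see `wedge_zero` and `wedge_succ_apply` for the values on vectors). -/
noncomputable def wedge : (p q : ℕ) →
    (V [⋀^Fin p]→L[ℝ] ℝ) →L[ℝ] (V [⋀^Fin q]→L[ℝ] ℝ) →L[ℝ] (V [⋀^Fin (q + p)]→L[ℝ] ℝ)
  | 0, _ =>
      (ContinuousLinearMap.lsmul ℝ ℝ) ∘L (ContinuousAlternatingMap.apply ℝ V ℝ (fun i => i.elim0))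
  | p + 1, q =>
      ((p : ℝ) + 1)⁻¹ •
        (ContinuousLinearMap.compL ℝ (V [⋀^Fin q]→L[ℝ] ℝ) (V →L[ℝ] V [⋀^Fin (q + p)]→L[ℝ] ℝ)
            (V [⋀^Fin (q + p + 1)]→L[ℝ] ℝ)
            (ContinuousAlternatingMap.alternatizeUncurryFinCLM ℝ V ℝ)) ∘L
          (ContinuousLinearMap.flipₗᵢ ℝ V (V [⋀^Fin q]→L[ℝ] ℝ)
            (V [⋀^Fin (q + p)]→L[ℝ] ℝ)).toContinuousLinearEquiv.toContinuousLinearMap ∘L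
            (ContinuousLinearMap.compL ℝ V (V [⋀^Fin p]→L[ℝ] ℝ)
              ((V [⋀^Fin q]→L[ℝ] ℝ) →L[ℝ] (V [⋀^Fin (q + p)]→L[ℝ] ℝ)) (wedge p q)) ∘L
              ContinuousAlternatingMap.curryLeftLI.toContinuousLinearMap

theorem wedge_zero (q : ℕ) (a : V [⋀^Fin 0]→L[ℝ] ℝ) (b : V [⋀^Fin q]→L[ℝ] ℝ) :
    wedge 0 q a b = a (fun i => i.elim0) • b := rfl

theorem wedge_succ (p q : ℕ) (a : V [⋀^Fin (p + 1)]→L[ℝ] ℝ) (b : V [⋀^Fin q]→L[ℝ] ℝ) :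
    wedge (p + 1) q a b = ((p : ℝ) + 1)⁻¹ • ContinuousAlternatingMap.alternatizeUncurryFin
      (((wedge p q) ∘L a.curryLeft).flip b) := rfl

theorem wedge_succ_apply (p q : ℕ) (a : V [⋀^Fin (p + 1)]→L[ℝ] ℝ) (b : V [⋀^Fin q]→L[ℝ] ℝ)
    (v : Fin (q + (p + 1)) → V) :
    wedge (p + 1) q a b v = ((p : ℝ) + 1)⁻¹ * ∑ i : Fin (q + p + 1), (-1 : ℝ) ^ (i : ℕ) *
      wedge p q (a.curryLeft (v i)) b (i.removeNth v) := by
  rw [wedge_succ]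
  simp [ContinuousAlternatingMap.alternatizeUncurryFin_apply]

variable (V) in
/-- The spinor module `⋀ V*`: an element `φ` is a family of its homogeneous components
`φ k ∈ ⋀ᵏ V*`. (For `k > dim V` there is no nonzero component, so for a finite-dimensional `V`
the product over `k` is the same as the direct sum.) -/
abbrev Spinor : Type _ := (k : ℕ) → V [⋀^Fin k]→L[ℝ] ℝ

/-- The contraction `ι(v) φ`. -/
noncomputable def contract (v : V) (φ : Spinor V) : Spinor V :=
  fun k => (φ (k + 1)).curryLeft v

/-- The exterior product `α ∧ φ` of a covector `α` with `φ`; its value on `v₀, …, v_k` is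
`∑ i, (-1) ^ i * α(v_i) * φ(v₀, …, v̂_i, …, v_k)`. -/
noncomputable def covectorWedge (α : V →L[ℝ] ℝ) (φ : Spinor V) : Spinor V
  | 0 => 0
  | k + 1 => ContinuousAlternatingMap.alternatizeUncurryFin (α.smulRight (φ k))

/-- The exterior product `η ∧ φ` of a `3`-form `η` with `φ`. -/
noncomputable def threeFormWedge (η : V [⋀^Fin 3]→L[ℝ] ℝ) (φ : Spinor V) : Spinor V
  | k + 3 => wedge 3 k η (φ k)
  | _ => 0

/-- The Clifford action `ρ(v ⊕ α) φ = ι(v) φ + α ∧ φ` of `V ⊕ V*` on `⋀ V*`. -/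
noncomputable def cliffordAct (w : V × (V →L[ℝ] ℝ)) (φ : Spinor V) : Spinor V :=
  contract w.1 φ + covectorWedge w.2 φ

/-- The null space `N_φ = {w | ρ(w) φ = 0}`. -/
def nullSpace (φ : Spinor V) : Set (V × (V →L[ℝ] ℝ)) := {w | cliffordAct w φ = 0}

end LinearAlgebra

/-! ### Sections of `𝕋M = TM ⊕ T*M` and differential forms on a manifold `M` -/

section Manifold

variable {V : Type*} [NormedAddCommGroup V] [NormedSpace ℝ V]
  {M : Type*} [TopologicalSpace M] [ChartedSpace V M]

variable (V) in
/-- The fibre at `x` of the generalized tangent bundle `𝕋M = TM ⊕ T*M`. -/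
abbrev GenTangent (x : M) : Type _ :=
  TangentSpace 𝓘(ℝ, V) x × (TangentSpace 𝓘(ℝ, V) x →L[ℝ] ℝ)

variable (V M) in
/-- Not necessarily smooth sections `w = v ⊕ α` of `𝕋M`. -/
abbrev GenField : Type _ := (x : M) → GenTangent V x

variable (V M) in
/-- Not necessarily smooth `k`-forms on `M`. -/
abbrev FormField (k : ℕ) : Type _ := (x : M) → TangentSpace 𝓘(ℝ, V) x [⋀^Fin k]→L[ℝ] ℝ

variable (V M) in
/-- Not necessarily smooth inhomogeneous differential forms on `M`: `φ x k` is the component of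
degree `k` at the point `x`. -/
abbrev SpinorField : Type _ :=
  (x : M) → (k : ℕ) → TangentSpace 𝓘(ℝ, V) x [⋀^Fin k]→L[ℝ] ℝ

variable [IsManifold 𝓘(ℝ, V) ∞ M]

/-- The section `w = v ⊕ α` of `𝕋M` is smooth on `U`. -/
def GenField.SmoothOn (w : GenField V M) (U : Set M) : Prop :=
  ContMDiffOn 𝓘(ℝ, V) (𝓘(ℝ, V).prod 𝓘(ℝ, V)) ∞
      (fun x => TotalSpace.mk' V (E := fun x : M => TangentSpace 𝓘(ℝ, V) x) x (w x).1) U ∧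
    ContMDiffOn 𝓘(ℝ, V) (𝓘(ℝ, V).prod 𝓘(ℝ, V →L[ℝ] ℝ)) ∞
      (fun x => TotalSpace.mk' (V →L[ℝ] ℝ)
        (E := fun x : M => TangentSpace 𝓘(ℝ, V) x →L[ℝ] Trivial M ℝ x) x (w x).2) U

/-- The `k`-form `a` is smooth on `U`, as a section of the bundle `⋀ᵏ T*M`. -/
def FormField.SmoothOn {k : ℕ} (a : FormField V M k) (U : Set M) : Prop :=
  ContMDiffOn 𝓘(ℝ, V) (𝓘(ℝ, V).prod 𝓘(ℝ, V [⋀^Fin k]→L[ℝ] ℝ)) ∞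
    (fun x => TotalSpace.mk' (V [⋀^Fin k]→L[ℝ] ℝ)
      (E := fun x : M => TangentSpace 𝓘(ℝ, V) x [⋀^Fin k]→L[ℝ] Trivial M ℝ x) x (a x)) U

/-- `φ` is a smooth differential form on `U`. -/
def SpinorField.SmoothOn (φ : SpinorField V M) (U : Set M) : Prop :=
  ∀ k : ℕ, FormField.SmoothOn (fun x => φ x k) U

/-- The `k`-form `a` read in the chart of `M` around `x₀`: its pullback under the inverse of
the chart, a `k`-form on the model space. -/
noncomputable def FormField.inChart {k : ℕ} (a : FormField V M k) (x₀ : M) (y : V) :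
    V [⋀^Fin k]→L[ℝ] ℝ :=
  (a ((extChartAt 𝓘(ℝ, V) x₀).symm y)).compContinuousLinearMap
    (mfderiv 𝓘(ℝ, V) 𝓘(ℝ, V) (extChartAt 𝓘(ℝ, V) x₀).symm y)

/-- The exterior derivative of a `k`-form on `M`: at `x`, the pullback under the chart around `x`
of the exterior derivative of the form read in that chart. -/
noncomputable def FormField.extDeriv {k : ℕ} (a : FormField V M k) : FormField V M (k + 1) :=
  fun x => ContinuousAlternatingMap.compContinuousLinearMap
    (_root_.extDeriv (a.inChart x) (extChartAt 𝓘(ℝ, V) x x))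
    (mfderiv 𝓘(ℝ, V) 𝓘(ℝ, V) (extChartAt 𝓘(ℝ, V) x) x)

/-- The exterior derivative `d` on inhomogeneous differential forms. -/
noncomputable def SpinorField.extDeriv (φ : SpinorField V M) : SpinorField V M :=
  fun x k => match k with
    | 0 => 0
    | j + 1 => FormField.extDeriv (fun y => φ y j) x

/-- The exterior product `η ∧ φ` of a `3`-form `η` on `M` with a differential form `φ`. -/
noncomputable def wedgeThreeForm (η : FormField V M 3) (φ : SpinorField V M) : SpinorField V M :=
  fun x => threeFormWedge (V := V) (η x) (φ x)

/-- The operator `d + η` on differential forms, `φ ↦ dφ + η ∧ φ`. -/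
noncomputable def twistedD (η : FormField V M 3) (φ : SpinorField V M) : SpinorField V M :=
  φ.extDeriv + wedgeThreeForm η φ

/-- The operator `ρ(w)` on differential forms. -/
noncomputable def rho (w : GenField V M) (φ : SpinorField V M) : SpinorField V M :=
  fun x => cliffordAct (V := V) (w x) (φ x)

/-! ### The Courant bracket as a derived bracket -/

/-- The graded commutator `[A, B] = AB + BA` of two odd operators on differential forms. -/
noncomputable def oddCommutator (A B : SpinorField V M → SpinorField V M) (φ : SpinorField V M) :
    SpinorField V M :=
  A (B φ) + B (A φ)

/-- The graded commutator `[A, B] = AB - BA` of an odd operator `A` and an even operator `B`. -/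
noncomputable def evenCommutator (A B : SpinorField V M → SpinorField V M) (φ : SpinorField V M) :
    SpinorField V M :=
  A (B φ) - B (A φ)

/-- `w` is a smooth section of `𝕋M` with `ρ(w) = [ρ(w₁), [ρ(w₂), d + η]]` on `Ω(M)`. -/
def IsCourantBracket (η : FormField V M 3) (w₁ w₂ w : GenField V M) : Prop :=
  w.SmoothOn Set.univ ∧
    ∀ φ : SpinorField V M, φ.SmoothOn Set.univ →
      rho w φ = evenCommutator (rho w₁) (oddCommutator (rho w₂) (twistedD η)) φ

/-- The Courant bracket `⟦w₁, w₂⟧` of smooth sections of `𝕋M` relative to `η`: the smooth section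
of `𝕋M` characterised by `ρ(⟦w₁, w₂⟧) = [ρ(w₁), [ρ(w₂), d + η]]`. -/
noncomputable def courantBracket (η : FormField V M 3) (w₁ w₂ : GenField V M) : GenField V M :=
  Classical.epsilon (IsCourantBracket η w₁ w₂)

/-! ### Almost Dirac structures and their integrability -/

/-- An almost Dirac structure: a smooth subbundle `E` of `𝕋M` (every point has a neighbourhood on
which `E` has a smooth frame) whose fibres are Lagrangian. -/
structure IsAlmostDirac (E : (x : M) → Submodule ℝ (GenTangent V x)) : Prop where
  exists_frame : ∀ x₀ : M, ∃ U : Set M, IsOpen U ∧ x₀ ∈ U ∧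
    ∃ (r : ℕ) (e : Fin r → GenField V M), (∀ i, (e i).SmoothOn U) ∧
      ∀ x ∈ U, LinearIndependent ℝ (fun i => e i x) ∧
        Submodule.span ℝ (Set.range fun i => e i x) = E x
  isLagrangian : ∀ x : M, IsLagrangian (E x)

/-- The smooth sections of `E` over `U`. -/
def sectionsOn (E : (x : M) → Submodule ℝ (GenTangent V x)) (U : Set M) : Set (GenField V M) :=
  {w | w.SmoothOn U ∧ ∀ x ∈ U, w x ∈ E x}

/-- The filtration `Ω^{(k)}(U)` of the differential forms on an open set `U` defined by `E`:
`γ` belongs to it iff `ρ(w₀) ⋯ ρ(w_k) γ = 0` on `U` for all smooth sections `w₀, …, w_k` of `E`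
over `U`. -/
def MemFiltration (E : (x : M) → Submodule ℝ (GenTangent V x)) (U : Set M) (k : ℕ)
    (γ : SpinorField V M) : Prop :=
  ∀ w : Fin (k + 1) → GenField V M, (∀ i, w i ∈ sectionsOn E U) →
    ∀ x ∈ U, (List.ofFn w).foldr rho γ x = 0

/-- `φ` is a pure spinor on `U` defining `E`: a smooth differential form on `U` that vanishes
nowhere on `U`, with null space `N_φ = E` at all points of `U`. -/
structure IsPureSpinorOn (E : (x : M) → Submodule ℝ (GenTangent V x)) (U : Set M)
    (φ : SpinorField V M) : Prop where
  smooth : φ.SmoothOn U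
  ne_zero : ∀ x ∈ U, φ x ≠ 0
  nullSpace_eq : ∀ x ∈ U, ∀ w : GenTangent V x, w ∈ nullSpace (V := V) (φ x) ↔ w ∈ E x

/-- `E` is Courant integrable relative to `η`: for every pure spinor `φ` with `N_φ = E`, defined
on some open set `U`, the class of `(d + η) φ ∈ Ω^{(3)}(U)` in
`gr³ = Ω^{(3)}(U) / Ω^{(2)}(U)` vanishes, that is, `(d + η) φ ∈ Ω^{(2)}(U)`. -/
def IsCourantIntegrable (E : (x : M) → Submodule ℝ (GenTangent V x)) (η : FormField V M 3) :
    Prop :=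
  ∀ U : Set M, IsOpen U → ∀ φ : SpinorField V M, IsPureSpinorOn E U φ →
    MemFiltration E U 2 (twistedD η φ)

/-! ### Lie algebroids -/

/-- The bracket `br` makes the subbundle `E` of `𝕋M` a Lie algebroid whose anchor is the
restriction to `E` of the projection `𝕋M → TM`: `br` is a Lie bracket on the space `Γ(E)` of smooth
sections, the anchor is a homomorphism to the Lie algebra of vector fields, and the Leibniz rule
holds. -/
structure IsLieAlgebroid (E : (x : M) → Submodule ℝ (GenTangent V x))
    (br : GenField V M → GenField V M → GenField V M) : Prop where
  closed : ∀ w₁ ∈ sectionsOn E Set.univ, ∀ w₂ ∈ sectionsOn E Set.univ,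
    br w₁ w₂ ∈ sectionsOn E Set.univ
  add_left : ∀ w₁ ∈ sectionsOn E Set.univ, ∀ w₂ ∈ sectionsOn E Set.univ,
    ∀ w₃ ∈ sectionsOn E Set.univ, br (w₁ + w₂) w₃ = br w₁ w₃ + br w₂ w₃
  smul_left : ∀ c : ℝ, ∀ w₁ ∈ sectionsOn E Set.univ, ∀ w₂ ∈ sectionsOn E Set.univ,
    br (c • w₁) w₂ = c • br w₁ w₂
  add_right : ∀ w₁ ∈ sectionsOn E Set.univ, ∀ w₂ ∈ sectionsOn E Set.univ,
    ∀ w₃ ∈ sectionsOn E Set.univ, br w₁ (w₂ + w₃) = br w₁ w₂ + br w₁ w₃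
  smul_right : ∀ c : ℝ, ∀ w₁ ∈ sectionsOn E Set.univ, ∀ w₂ ∈ sectionsOn E Set.univ,
    br w₁ (c • w₂) = c • br w₁ w₂
  self : ∀ w ∈ sectionsOn E Set.univ, br w w = 0
  jacobi : ∀ w₁ ∈ sectionsOn E Set.univ, ∀ w₂ ∈ sectionsOn E Set.univ,
    ∀ w₃ ∈ sectionsOn E Set.univ, br w₁ (br w₂ w₃) + br w₂ (br w₃ w₁) + br w₃ (br w₁ w₂) = 0
  anchor : ∀ w₁ ∈ sectionsOn E Set.univ, ∀ w₂ ∈ sectionsOn E Set.univ, ∀ x : M,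
    (br w₁ w₂ x).1 = VectorField.mlieBracket 𝓘(ℝ, V) (fun y => (w₁ y).1) (fun y => (w₂ y).1) x
  leibniz : ∀ f : M → ℝ, ContMDiff 𝓘(ℝ, V) 𝓘(ℝ, ℝ) ∞ f →
    ∀ w₁ ∈ sectionsOn E Set.univ, ∀ w₂ ∈ sectionsOn E Set.univ, ∀ x : M,
      br w₁ (fun y => f y • w₂ y) x =
        f x • br w₁ w₂ x + (show ℝ from mfderiv 𝓘(ℝ, V) 𝓘(ℝ, ℝ) f x (w₁ x).1) • w₂ x

end Manifold

section CliffordAlgebra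

variable {V : Type*} [NormedAddCommGroup V] [NormedSpace ℝ V]

open ContinuousAlternatingMap in
/-- The contraction `ι(v)` of forms of positive degree, as a continuous linear map. -/
noncomputable def iotaCLM {k : ℕ} (v : V) : (V [⋀^Fin (k + 1)]→L[ℝ] ℝ) →L[ℝ] (V [⋀^Fin k]→L[ℝ] ℝ) :=
  (curryLeftLI (𝕜 := ℝ) (E := V) (F := ℝ) (n := k)).toContinuousLinearMap.flip v

@[simp] theorem iotaCLM_apply {k : ℕ} (v : V) (a : V [⋀^Fin (k + 1)]→L[ℝ] ℝ) :
    iotaCLM v a = a.curryLeft v := rfl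

theorem curryLeft_alternatizeUncurryFin {p : ℕ} (β : V →L[ℝ] V [⋀^Fin (p + 1)]→L[ℝ] ℝ) (v : V) :
    (ContinuousAlternatingMap.alternatizeUncurryFin β).curryLeft v =
      β v - ContinuousAlternatingMap.alternatizeUncurryFin (iotaCLM v ∘L β) := by
  ext u
  simp only [ContinuousAlternatingMap.curryLeft_apply_apply,
    ContinuousAlternatingMap.alternatizeUncurryFin_apply, ContinuousAlternatingMap.sub_apply]
  rw [Fin.sum_univ_succ, sub_eq_add_neg, ← Finset.sum_neg_distrib]
  congr 1
  · simp
  · refine Finset.sum_congr rfl fun i _ => ?_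
    have : Matrix.vecCons v (i.removeNth u) = i.succ.removeNth (Matrix.vecCons v u) := by
      funext j
      cases j using Fin.cases <;> simp [Fin.removeNth]
    simp [pow_succ, this]

theorem curryLeft_alternatizeUncurryFin_zero (β : V →L[ℝ] V [⋀^Fin 0]→L[ℝ] ℝ) (v : V) :
    (ContinuousAlternatingMap.alternatizeUncurryFin β).curryLeft v = β v := by
  ext u
  simp [ContinuousAlternatingMap.alternatizeUncurryFin_apply]

noncomputable instance Spinor.instRingEnd : Ring (Module.End ℝ (Spinor V)) := Module.End.instRing

/-- The contraction `ι(v)` as an endomorphism of the spinor module, linear in `v`. -/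
noncomputable def contractEnd : V →ₗ[ℝ] Module.End ℝ (Spinor V) where
  toFun v :=
    { toFun := contract v
      map_add' := fun φ ψ => by funext k; simp [contract]
      map_smul' := fun c φ => by funext k; simp [contract] }
  map_add' v w := by ext1 φ; funext k; simp [contract]
  map_smul' c v := by ext1 φ; funext k; simp [contract]

/-- The exterior product with a covector as an endomorphism of the spinor module. -/
noncomputable def covectorEnd : (V →L[ℝ] ℝ) →ₗ[ℝ] Module.End ℝ (Spinor V) where
  toFun α :=
    { toFun := covectorWedge α
      map_add' := fun φ ψ => by
        funext k
        cases k with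
        | zero => simp [covectorWedge]
        | succ k =>
          simp only [covectorWedge, Pi.add_apply, ← ContinuousAlternatingMap.alternatizeUncurryFin_add]
          congr 1; ext; simp
      map_smul' := fun c φ => by
        funext k
        cases k with
        | zero => simp [covectorWedge]
        | succ k =>
          simp only [covectorWedge, Pi.smul_apply, RingHom.id_apply,
            ← ContinuousAlternatingMap.alternatizeUncurryFin_smul]
          congr 1; ext; simp; ring }
  map_add' α β := by
    ext1 φ; funext k
    cases k with
    | zero => simp [covectorWedge]
    | succ k =>
      simp only [covectorWedge, LinearMap.add_apply, LinearMap.coe_mk, AddHom.coe_mk, Pi.add_apply,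
        ← ContinuousAlternatingMap.alternatizeUncurryFin_add]
      congr 1; ext; simp [add_mul]
  map_smul' c β := by
    ext1 φ; funext k
    cases k with
    | zero => simp [covectorWedge]
    | succ k =>
      simp only [covectorWedge, LinearMap.smul_apply, LinearMap.coe_mk, AddHom.coe_mk,
        Pi.smul_apply, RingHom.id_apply, ← ContinuousAlternatingMap.alternatizeUncurryFin_smul]
      congr 1; ext; simp [mul_assoc]

@[simp] theorem contractEnd_apply (v : V) (φ : Spinor V) : contractEnd v φ = contract v φ := rfl

@[simp] theorem covectorEnd_apply (α : V →L[ℝ] ℝ) (φ : Spinor V) :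
    covectorEnd α φ = covectorWedge α φ := rfl

/-- The Clifford action as a linear map to the endomorphisms of the spinor module. -/
noncomputable def cliffordEnd : V × (V →L[ℝ] ℝ) →ₗ[ℝ] Module.End ℝ (Spinor V) :=
  contractEnd.coprod covectorEnd

theorem cliffordEnd_def (w : V × (V →L[ℝ] ℝ)) :
    cliffordEnd w = contractEnd w.1 + covectorEnd w.2 := rfl

@[simp] theorem cliffordEnd_apply (w : V × (V →L[ℝ] ℝ)) (φ : Spinor V) :
    cliffordEnd w φ = cliffordAct w φ := rfl

theorem contractEnd_mul_self (v : V) : contractEnd v * contractEnd v = 0 := by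
  ext1 φ; funext k
  simp [contract]

theorem covectorEnd_mul_self (α : V →L[ℝ] ℝ) : covectorEnd α * covectorEnd α = 0 := by
  ext1 φ; funext k
  match k with
  | 0 => simp [covectorWedge]
  | 1 =>
    simp only [Module.End.mul_apply, covectorEnd_apply, covectorWedge]
    ext u; simp [ContinuousAlternatingMap.alternatizeUncurryFin_apply]
  | k + 2 =>
    have h := ContinuousAlternatingMap.alternatizeUncurryFin_alternatizeUncurryFinCLM_comp_of_symmetric
      (f := α.smulRight (α.smulRight (φ k))) (fun x y => by ext u; simp; ring)
    simp only [Module.End.mul_apply, covectorEnd_apply, covectorWedge]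
    refine Eq.trans (congrArg _ (ContinuousLinearMap.ext fun x => ?_)) h
    exact (map_smul (ContinuousAlternatingMap.alternatizeUncurryFinCLM ℝ V ℝ) (α x)
      (α.smulRight (φ k))).symm

theorem contractEnd_mul_covectorEnd (v : V) (α : V →L[ℝ] ℝ) :
    contractEnd v * covectorEnd α = α v • 1 - covectorEnd α * contractEnd v := by
  ext1 φ; funext k
  cases k with
  | zero =>
    simp only [Module.End.mul_apply, covectorEnd_apply, contractEnd_apply, contract, covectorWedge,
      curryLeft_alternatizeUncurryFin_zero, LinearMap.sub_apply, Pi.sub_apply]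
    simp
  | succ k =>
    simp only [Module.End.mul_apply, covectorEnd_apply, contractEnd_apply, contract, covectorWedge,
      curryLeft_alternatizeUncurryFin, LinearMap.sub_apply, Pi.sub_apply]
    congr 2

theorem cliffordEnd_mul_self (w : V × (V →L[ℝ] ℝ)) :
    cliffordEnd w * cliffordEnd w = w.2 w.1 • 1 := by
  rw [cliffordEnd_def, add_mul, mul_add, mul_add, contractEnd_mul_self, covectorEnd_mul_self,
    contractEnd_mul_covectorEnd]
  abel

theorem cliffordEnd_mul_add_mul (u w : V × (V →L[ℝ] ℝ)) :
    cliffordEnd u * cliffordEnd w + cliffordEnd w * cliffordEnd u = diracPairing u w • 1 := by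
  have h := cliffordEnd_mul_self (u + w)
  rw [map_add, add_mul, mul_add, mul_add, cliffordEnd_mul_self, cliffordEnd_mul_self] at h
  simp only [Prod.fst_add, Prod.snd_add, add_apply, map_add] at h
  rw [diracPairing]
  linear_combination (norm := module) h

theorem cliffordAct_cliffordAct_add (u w : V × (V →L[ℝ] ℝ)) (φ : Spinor V) :
    cliffordAct u (cliffordAct w φ) + cliffordAct w (cliffordAct u φ) = diracPairing u w • φ :=
  congr($(cliffordEnd_mul_add_mul u w) φ)

theorem covectorEnd_eq_cliffordEnd (α : V →L[ℝ] ℝ) : covectorEnd α = cliffordEnd ((0 : V), α) := by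
  simp [cliffordEnd_def]

theorem covectorEnd_mul_comm (α β : V →L[ℝ] ℝ) :
    covectorEnd α * covectorEnd β = -(covectorEnd β * covectorEnd α) := by
  rw [eq_neg_iff_add_eq_zero, covectorEnd_eq_cliffordEnd, covectorEnd_eq_cliffordEnd,
    cliffordEnd_mul_add_mul]
  simp [diracPairing]

theorem cliffordEnd_mul_covectorEnd (w : V × (V →L[ℝ] ℝ)) (α : V →L[ℝ] ℝ) :
    cliffordEnd w * covectorEnd α = α w.1 • 1 - covectorEnd α * cliffordEnd w := by
  rw [eq_sub_iff_add_eq, covectorEnd_eq_cliffordEnd, cliffordEnd_mul_add_mul]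
  simp [diracPairing]

end CliffordAlgebra

section FormAction

variable {V : Type*} [NormedAddCommGroup V] [NormedSpace ℝ V] [FiniteDimensional ℝ V]

variable (V) in
/-- A basis of `V`. -/
noncomputable abbrev frame : Module.Basis (Fin (Module.finrank ℝ V)) ℝ V := Module.finBasis ℝ V

variable (V) in
/-- The basis of covectors dual to `frame V`. -/
noncomputable def coframe (i : Fin (Module.finrank ℝ V)) : V →L[ℝ] ℝ :=
  LinearMap.toContinuousLinearMap ((frame V).coord i)

theorem sum_coframe_smul (v : V) : ∑ i, coframe V i v • frame V i = v :=
  (frame V).sum_repr v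

theorem sum_coframe_smul_map {W : Type*} [AddCommGroup W] [Module ℝ W] (f : V →ₗ[ℝ] W) (v : V) :
    ∑ i, coframe V i v • f (frame V i) = f v := by
  conv_rhs => rw [← sum_coframe_smul v]
  simp

theorem sum_coframe_smulRight {W : Type*} [NormedAddCommGroup W] [NormedSpace ℝ W]
    (f : V →L[ℝ] W) : ∑ i, (coframe V i).smulRight (f (frame V i)) = f := by
  ext v
  simpa using sum_coframe_smul_map f.toLinearMap v

/-- The exterior product with a `p`-form as an endomorphism of the spinor module. -/
noncomputable def formEnd : (p : ℕ) → (V [⋀^Fin p]→L[ℝ] ℝ) →ₗ[ℝ] Module.End ℝ (Spinor V)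
  | 0 => LinearMap.toSpanSingleton ℝ (Module.End ℝ (Spinor V)) 1 ∘ₗ
      (ContinuousAlternatingMap.apply ℝ V ℝ (fun i : Fin 0 => i.elim0)).toLinearMap
  | p + 1 => ((p : ℝ) + 1)⁻¹ • ∑ i, LinearMap.mulLeft ℝ (covectorEnd (coframe V i)) ∘ₗ
      formEnd p ∘ₗ (iotaCLM (frame V i)).toLinearMap

theorem formEnd_zero (a : V [⋀^Fin 0]→L[ℝ] ℝ) : formEnd 0 a = a (fun i => i.elim0) • 1 := rfl

theorem formEnd_succ (p : ℕ) (a : V [⋀^Fin (p + 1)]→L[ℝ] ℝ) :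
    formEnd (p + 1) a = ((p : ℝ) + 1)⁻¹ •
      ∑ i, covectorEnd (coframe V i) * formEnd p (a.curryLeft (frame V i)) := by
  simp [formEnd]

theorem succ_smul_formEnd_succ (p : ℕ) (a : V [⋀^Fin (p + 1)]→L[ℝ] ℝ) :
    ((p : ℝ) + 1) • formEnd (p + 1) a =
      ∑ i, covectorEnd (coframe V i) * formEnd p (a.curryLeft (frame V i)) := by
  rw [formEnd_succ, smul_smul, mul_inv_cancel₀ (by positivity), one_smul]

theorem formEnd_mul_covectorEnd (p : ℕ) (a : V [⋀^Fin p]→L[ℝ] ℝ) (α : V →L[ℝ] ℝ) :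
    formEnd p a * covectorEnd α = (-1 : ℝ) ^ p • (covectorEnd α * formEnd p a) := by
  induction p with
  | zero => simp [formEnd_zero]
  | succ p ih =>
    rw [formEnd_succ, smul_mul_assoc, mul_smul_comm, smul_comm, Finset.sum_mul, Finset.mul_sum]
    refine congrArg (((p : ℝ) + 1)⁻¹ • ·) ?_
    rw [Finset.smul_sum]
    refine Finset.sum_congr rfl fun i _ => ?_
    rw [mul_assoc, ih, mul_smul_comm, ← mul_assoc, covectorEnd_mul_comm, ← mul_assoc, pow_succ]
    simp

theorem sum_coframe_smul_formEnd (p : ℕ) (a : V [⋀^Fin (p + 1)]→L[ℝ] ℝ) (v : V) :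
    ∑ i, coframe V i v • formEnd p (a.curryLeft (frame V i)) = formEnd p (a.curryLeft v) := by
  simp only [← map_smul, ← map_sum, sum_coframe_smul]

theorem contractEnd_mul_formEnd_aux (p : ℕ) (a : V [⋀^Fin (p + 1)]→L[ℝ] ℝ) (v : V) :
    ((p : ℝ) + 1) • (contractEnd v * formEnd (p + 1) a) = formEnd p (a.curryLeft v) -
      ∑ i, covectorEnd (coframe V i) * (contractEnd v * formEnd p (a.curryLeft (frame V i))) := by
  rw [← mul_smul_comm, succ_smul_formEnd_succ, Finset.mul_sum, ← sum_coframe_smul_formEnd,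
    ← Finset.sum_sub_distrib]
  refine Finset.sum_congr rfl fun i _ => ?_
  rw [← mul_assoc, contractEnd_mul_covectorEnd, sub_mul, mul_assoc, smul_mul_assoc, one_mul]

theorem contractEnd_mul_formEnd_zero (a : V [⋀^Fin 0]→L[ℝ] ℝ) (v : V) :
    contractEnd v * formEnd 0 a = formEnd 0 a * contractEnd v := by
  simp [formEnd_zero]

theorem contractEnd_mul_formEnd_succ (p : ℕ) (a : V [⋀^Fin (p + 1)]→L[ℝ] ℝ) (v : V) :
    contractEnd v * formEnd (p + 1) a =
      formEnd p (a.curryLeft v) + (-1 : ℝ) ^ (p + 1) • (formEnd (p + 1) a * contractEnd v) := by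
  have hp : ((p : ℝ) + 1) ≠ 0 := by positivity
  refine smul_right_injective _ hp ?_
  dsimp only
  rw [contractEnd_mul_formEnd_aux, smul_add, smul_comm, ← smul_mul_assoc, succ_smul_formEnd_succ]
  induction p with
  | zero =>
    simp only [contractEnd_mul_formEnd_zero, ← mul_assoc, ← Finset.sum_mul]
    simp [sub_eq_add_neg]
  | succ p ih =>
    have ih' (b : V [⋀^Fin (p + 1)]→L[ℝ] ℝ) : contractEnd v * formEnd (p + 1) b =
        formEnd p (b.curryLeft v) + (-1 : ℝ) ^ (p + 1) • (formEnd (p + 1) b * contractEnd v) := by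
      have hp : ((p : ℝ) + 1) ≠ 0 := by positivity
      refine smul_right_injective _ hp ?_
      dsimp only
      rw [contractEnd_mul_formEnd_aux, smul_add, smul_comm, ← smul_mul_assoc,
        succ_smul_formEnd_succ]
      exact ih b hp
    have hswap : ∑ i, covectorEnd (coframe V i) * formEnd p ((a.curryLeft (frame V i)).curryLeft v)
        = -(((p : ℝ) + 1) • formEnd (p + 1) (a.curryLeft v)) := by
      rw [succ_smul_formEnd_succ, ← Finset.sum_neg_distrib]
      refine Finset.sum_congr rfl fun i _ => ?_
      rw [← mul_neg, ← map_neg]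
      congr 2
      have h := a.curryLeft_same (v + frame V i)
      simp only [map_add, ContinuousAlternatingMap.curryLeft_add, add_apply,
        ContinuousAlternatingMap.curryLeft_same, zero_add, add_zero] at h
      exact eq_neg_of_add_eq_zero_left h
    simp only [ih', mul_add, Finset.sum_add_distrib, hswap, mul_smul_comm, ← Finset.smul_sum,
      ← mul_assoc, ← Finset.sum_mul]
    push_cast
    rw [pow_succ (-1 : ℝ) (p + 1)]
    module

theorem formEnd_mul_formEnd (p q : ℕ) (a : V [⋀^Fin p]→L[ℝ] ℝ) (b : V [⋀^Fin q]→L[ℝ] ℝ) :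
    formEnd p a * formEnd q b = (-1 : ℝ) ^ (p * q) • (formEnd q b * formEnd p a) := by
  induction p with
  | zero => simp [formEnd_zero]
  | succ p ih =>
    rw [formEnd_succ, smul_mul_assoc, mul_smul_comm, smul_comm, Finset.sum_mul, Finset.mul_sum]
    refine congrArg (((p : ℝ) + 1)⁻¹ • ·) ?_
    rw [Finset.smul_sum]
    refine Finset.sum_congr rfl fun i _ => ?_
    rw [mul_assoc, ih, mul_smul_comm, ← mul_assoc, ← mul_assoc, formEnd_mul_covectorEnd,
      smul_mul_assoc, smul_smul, add_mul, pow_add, one_mul, mul_assoc, mul_assoc,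
      ← mul_pow]
    simp

theorem formEnd_mul_self_of_odd {p : ℕ} (hp : Odd p) (a : V [⋀^Fin p]→L[ℝ] ℝ) :
    formEnd p a * formEnd p a = 0 := by
  have h := formEnd_mul_formEnd p p a a
  rw [(hp.mul hp).neg_one_pow, neg_one_smul] at h
  have h2 : (2 : ℝ) • (formEnd p a * formEnd p a) = 0 := by
    rw [two_smul]; nth_rewrite 1 [h]; simp
  simpa using h2

theorem sum_covectorEnd_mul_formEnd (p : ℕ) (β : V →L[ℝ] V [⋀^Fin p]→L[ℝ] ℝ) :
    ∑ i, covectorEnd (coframe V i) * formEnd p (β (frame V i)) =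
      formEnd (p + 1) (ContinuousAlternatingMap.alternatizeUncurryFin β) := by
  induction p with
  | zero =>
    rw [formEnd_succ]
    simp [curryLeft_alternatizeUncurryFin_zero]
  | succ p ih =>
    have hp : (((p + 1 : ℕ) : ℝ) + 1) ≠ 0 := by positivity
    refine smul_right_injective _ hp ?_
    dsimp only
    rw [succ_smul_formEnd_succ]
    have h : ∑ i, covectorEnd (coframe V i) * formEnd (p + 1)
        (ContinuousAlternatingMap.alternatizeUncurryFin (iotaCLM (frame V i) ∘L β)) =
        -(((p : ℝ) + 1) • ∑ i, covectorEnd (coframe V i) * formEnd (p + 1) (β (frame V i))) := by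
      simp only [← ih, Finset.mul_sum, Finset.smul_sum, ← mul_smul_comm, succ_smul_formEnd_succ]
      rw [Finset.sum_comm, ← Finset.sum_neg_distrib]
      refine Finset.sum_congr rfl fun i _ => ?_
      rw [← Finset.sum_neg_distrib]
      refine Finset.sum_congr rfl fun j _ => ?_
      rw [← mul_assoc, covectorEnd_mul_comm, ← mul_assoc]
      simp
    simp only [curryLeft_alternatizeUncurryFin, map_sub, mul_sub, Finset.sum_sub_distrib, h]
    push_cast
    module

theorem wedge_eq_formEnd (p q : ℕ) (a : V [⋀^Fin p]→L[ℝ] ℝ) (φ : Spinor V) :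
    wedge p q a (φ q) = formEnd p a φ (q + p) := by
  induction p with
  | zero => simp [formEnd_zero, wedge_zero]
  | succ p ih =>
    rw [wedge_succ, formEnd_succ]
    simp only [LinearMap.smul_apply, Pi.smul_apply, LinearMap.coe_sum, Finset.sum_apply,
      Module.End.mul_apply, covectorEnd_apply]
    congr 1
    rw [← sum_coframe_smulRight (((wedge p q) ∘L a.curryLeft).flip (φ q)),
      ← ContinuousAlternatingMap.alternatizeUncurryFinCLM_apply, map_sum]
    refine Finset.sum_congr rfl fun i _ => ?_
    simp [ih, covectorWedge]

theorem formEnd_apply_of_lt (p k : ℕ) (hk : k < p) (a : V [⋀^Fin p]→L[ℝ] ℝ) (φ : Spinor V) :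
    formEnd p a φ k = 0 := by
  induction p generalizing k with
  | zero => simp at hk
  | succ p ih =>
    rw [formEnd_succ]
    simp only [LinearMap.smul_apply, Pi.smul_apply, LinearMap.coe_sum, Finset.sum_apply,
      Module.End.mul_apply, covectorEnd_apply]
    rw [Finset.sum_eq_zero, smul_zero]
    intro i _
    cases k with
    | zero => rfl
    | succ k =>
      simp only [covectorWedge, ih k (by omega)]
      rw [← ContinuousAlternatingMap.alternatizeUncurryFinCLM_apply]
      exact (congrArg _ (by ext; simp)).trans (map_zero _)

theorem threeFormWedge_eq_formEnd (η : V [⋀^Fin 3]→L[ℝ] ℝ) (φ : Spinor V) :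
    threeFormWedge η φ = formEnd 3 η φ := by
  funext k
  match k with
  | 0 => rw [formEnd_apply_of_lt _ _ (by omega)]; rfl
  | 1 => rw [formEnd_apply_of_lt _ _ (by omega)]; rfl
  | 2 => rw [formEnd_apply_of_lt _ _ (by omega)]; rfl
  | k + 3 => exact wedge_eq_formEnd 3 k η φ

/-- A `1`-form as a covector. -/
noncomputable def toCovector : (V [⋀^Fin 1]→L[ℝ] ℝ) →L[ℝ] V →L[ℝ] ℝ :=
  ContinuousLinearMap.compL ℝ V (V [⋀^Fin 0]→L[ℝ] ℝ) ℝ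
      (ContinuousAlternatingMap.apply ℝ V ℝ (fun i : Fin 0 => i.elim0)) ∘L
    ContinuousAlternatingMap.curryLeftLI.toContinuousLinearMap

theorem formEnd_one (a : V [⋀^Fin 1]→L[ℝ] ℝ) : formEnd 1 a = covectorEnd (toCovector a) := by
  have h : ∑ i, (toCovector a (frame V i)) • coframe V i = toCovector a := by
    ext v
    have := sum_coframe_smul_map (toCovector a).toLinearMap v
    simpa [mul_comm] using this
  rw [formEnd_succ, ← h]
  simp [formEnd_zero, toCovector]

end FormAction

section Pullback

variable {V : Type*} [NormedAddCommGroup V] [NormedSpace ℝ V]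
  {W : Type*} [NormedAddCommGroup W] [NormedSpace ℝ W]

/-- The pullback of a spinor under a linear map. -/
noncomputable def Spinor.pullback (L : V →L[ℝ] W) (φ : Spinor W) : Spinor V :=
  fun k => (φ k).compContinuousLinearMap L

theorem contract_pullback (L : V →L[ℝ] W) (v : V) (φ : Spinor W) :
    contract v (φ.pullback L) = (contract (L v) φ).pullback L := by
  funext k
  simp [contract, Spinor.pullback]

theorem covectorWedge_pullback (L : V →L[ℝ] W) (α : W →L[ℝ] ℝ) (φ : Spinor W) :
    covectorWedge (α ∘L L) (φ.pullback L) = (covectorWedge α φ).pullback L := by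
  funext k
  cases k with
  | zero => ext; simp [covectorWedge, Spinor.pullback]
  | succ k =>
    ext u
    simp only [covectorWedge, Spinor.pullback, ContinuousAlternatingMap.alternatizeUncurryFin_apply,
      ContinuousAlternatingMap.compContinuousLinearMap_apply]
    rfl

theorem cliffordAct_pullback (L : V →L[ℝ] W) (v : V) (α : W →L[ℝ] ℝ) (φ : Spinor W) :
    cliffordAct (v, α ∘L L) (φ.pullback L) = (cliffordAct (L v, α) φ).pullback L := by
  simp only [cliffordAct, contract_pullback, covectorWedge_pullback]
  rfl

theorem wedge_compContinuousLinearMap (p q : ℕ) (L : V →L[ℝ] W) (a : W [⋀^Fin p]→L[ℝ] ℝ)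
    (b : W [⋀^Fin q]→L[ℝ] ℝ) :
    wedge p q (a.compContinuousLinearMap L) (b.compContinuousLinearMap L) =
      (wedge p q a b).compContinuousLinearMap L := by
  induction p with
  | zero =>
    ext u
    have : (L ∘ fun i : Fin 0 => (i.elim0 : V)) = fun i => i.elim0 := Subsingleton.elim _ _
    simp [wedge_zero, this]
  | succ p ih =>
    ext u
    rw [wedge_succ_apply, ContinuousAlternatingMap.compContinuousLinearMap_apply, wedge_succ_apply]
    congr 1
    refine Finset.sum_congr rfl fun i _ => ?_
    rw [ContinuousAlternatingMap.curryLeft_compContinuousLinearMap, ih]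
    rfl

theorem threeFormWedge_pullback (L : V →L[ℝ] W) (η : W [⋀^Fin 3]→L[ℝ] ℝ) (φ : Spinor W) :
    threeFormWedge (η.compContinuousLinearMap L) (φ.pullback L) =
      (threeFormWedge η φ).pullback L := by
  funext k
  match k with
  | 0 => ext; simp [threeFormWedge, Spinor.pullback]
  | 1 => ext; simp [threeFormWedge, Spinor.pullback]
  | 2 => ext; simp [threeFormWedge, Spinor.pullback]
  | k + 3 => exact wedge_compContinuousLinearMap 3 k L η (φ k)

end Pullback

section Pairing

variable {V : Type*} [NormedAddCommGroup V] [NormedSpace ℝ V]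

theorem diracPairing_comm (u w : V × (V →L[ℝ] ℝ)) : diracPairing u w = diracPairing w u :=
  add_comm _ _

/-- The symmetric bilinear form `B(u, w) + B(w, u)`. -/
noncomputable def symmetrizeCLM {P : Type*} [NormedAddCommGroup P] [NormedSpace ℝ P]
    (B : P →L[ℝ] P →L[ℝ] ℝ) : P →L[ℝ] P →L[ℝ] ℝ :=
  B + B.flip

variable (V) in
/-- The bilinear form `α₁(v₂)` on `V ⊕ V*`. -/
noncomputable def evalFstCLM : (V × (V →L[ℝ] ℝ)) →L[ℝ] (V × (V →L[ℝ] ℝ)) →L[ℝ] ℝ :=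
  (ContinuousLinearMap.compL ℝ (V × (V →L[ℝ] ℝ)) V ℝ).flip
      (ContinuousLinearMap.fst ℝ V (V →L[ℝ] ℝ)) ∘L
    ContinuousLinearMap.snd ℝ V (V →L[ℝ] ℝ)

variable (V) in
/-- The pairing on `V ⊕ V*` as a continuous bilinear form. -/
noncomputable def diracPairingCLM : (V × (V →L[ℝ] ℝ)) →L[ℝ] (V × (V →L[ℝ] ℝ)) →L[ℝ] ℝ :=
  symmetrizeCLM (evalFstCLM V)

@[simp] theorem diracPairingCLM_apply (u w : V × (V →L[ℝ] ℝ)) :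
    diracPairingCLM V u w = diracPairing u w := rfl

/-- The spinor `1`, concentrated in degree `0`. -/
noncomputable def Spinor.one : Spinor V
  | 0 => ContinuousAlternatingMap.constOfIsEmpty ℝ V (Fin 0) 1
  | _ + 1 => 0

theorem Spinor.one_ne_zero : (Spinor.one : Spinor V) ≠ 0 := by
  intro h
  have := congr($(congrFun h 0) 0)
  simp [Spinor.one] at this

theorem eq_zero_of_diracPairing_eq_zero [FiniteDimensional ℝ V] {w : V × (V →L[ℝ] ℝ)}
    (h : ∀ u, diracPairing w u = 0) : w = 0 := by
  have h1 : w.1 = 0 := by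
    rw [← sum_coframe_smul w.1]
    refine Finset.sum_eq_zero fun i _ => ?_
    have := h (0, coframe V i)
    simp only [diracPairing, map_zero, zero_add] at this
    rw [this, zero_smul]
  have h2 : w.2 = 0 := by
    ext v
    simpa [diracPairing] using h (v, 0)
  exact Prod.ext h1 h2

theorem eq_of_forall_cliffordAct_eq [FiniteDimensional ℝ V] {w w' : V × (V →L[ℝ] ℝ)}
    (h : ∀ φ : Spinor V, cliffordAct w φ = cliffordAct w' φ) : w = w' := by
  have h0 : cliffordEnd (w - w') = 0 := by
    rw [map_sub, sub_eq_zero]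
    exact LinearMap.ext h
  rw [← sub_eq_zero]
  refine eq_zero_of_diracPairing_eq_zero fun u => ?_
  have := cliffordEnd_mul_add_mul (w - w') u
  rw [h0, zero_mul, mul_zero, add_zero] at this
  have := congr($this Spinor.one)
  simpa [Spinor.one_ne_zero, eq_comm] using this

theorem diracPairing_eq_zero_of_cliffordAct_eq_zero {u w : V × (V →L[ℝ] ℝ)} {φ : Spinor V}
    (hφ : φ ≠ 0) (hu : cliffordAct u φ = 0) (hw : cliffordAct w φ = 0) : diracPairing u w = 0 := by
  have h := cliffordAct_cliffordAct_add u w φ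
  rw [hu, hw, ← cliffordEnd_apply, ← cliffordEnd_apply, map_zero, map_zero, add_zero] at h
  exact (smul_eq_zero.1 h.symm).resolve_right hφ

theorem exists_diracPairing_eq [FiniteDimensional ℝ V] (f : V × (V →L[ℝ] ℝ) →ₗ[ℝ] ℝ) :
    ∃ u, ∀ w, diracPairing u w = f w := by
  refine ⟨(∑ i, f (0, coframe V i) • frame V i,
    LinearMap.toContinuousLinearMap (f ∘ₗ LinearMap.inl ℝ V (V →L[ℝ] ℝ))), fun w => ?_⟩
  have h : w.2 = ∑ i, w.2 (frame V i) • coframe V i := by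
    ext v
    have := sum_coframe_smul_map w.2.toLinearMap v
    simpa [mul_comm] using this.symm
  have h2 : f (0, w.2) = ∑ i, w.2 (frame V i) * f (0, coframe V i) := by
    have : f (0, w.2) = (f ∘ₗ LinearMap.inr ℝ V (V →L[ℝ] ℝ)) w.2 := rfl
    rw [this]
    conv_lhs => rw [h]
    simp only [map_sum, map_smul, smul_eq_mul]
    rfl
  have h3 : f w = f (w.1, 0) + f (0, w.2) := by rw [← map_add]; simp
  rw [h3, h2]
  simp [diracPairing, mul_comm]

theorem cliffordAct_foldr_of_diracPairing_eq_zero (u : V × (V →L[ℝ] ℝ))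
    (l : List (V × (V →L[ℝ] ℝ))) (h : ∀ w ∈ l, diracPairing u w = 0) (φ : Spinor V) :
    cliffordAct u (l.foldr cliffordAct φ) =
      l.foldr cliffordAct ((-1 : ℝ) ^ l.length • cliffordAct u φ) := by
  induction l with
  | nil => simp
  | cons w l ih =>
    have h1 := cliffordAct_cliffordAct_add u w (l.foldr cliffordAct φ)
    rw [h w (by simp), zero_smul, ih fun w' hw' => h w' (by simp [hw'])] at h1
    have hlin : ∀ (l : List (V × (V →L[ℝ] ℝ))) (c : ℝ) (ψ : Spinor V),
        l.foldr cliffordAct (c • ψ) = c • l.foldr cliffordAct ψ := by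
      intro l c ψ
      induction l with
      | nil => rfl
      | cons w l ih => rw [List.foldr_cons, ih, ← cliffordEnd_apply, map_smul]; rfl
    rw [List.foldr_cons, eq_neg_of_add_eq_zero_left h1, List.length_cons, hlin, hlin,
      List.foldr_cons, pow_succ, ← cliffordEnd_apply, map_smul, mul_neg_one]
    exact (neg_smul _ _).symm

/-- The product of the Clifford actions of linearly independent elements is not zero. -/
theorem exists_foldr_cliffordAct_ne_zero [FiniteDimensional ℝ V] {r : ℕ}
    (e : Fin r → V × (V →L[ℝ] ℝ)) (he : LinearIndependent ℝ e) :
    ∃ s : Spinor V, (List.ofFn e).foldr cliffordAct s ≠ 0 := by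
  induction r with
  | zero => exact ⟨Spinor.one, by simpa using Spinor.one_ne_zero⟩
  | succ r ih =>
    obtain ⟨s, hs⟩ := ih (fun i => e i.succ) (he.comp _ (Fin.succ_injective r))
    by_contra! hall
    obtain ⟨f, hf⟩ : ∃ f : V × (V →L[ℝ] ℝ) →ₗ[ℝ] ℝ,
        ∀ i, f (e i) = (Pi.single 0 1 : Fin (r + 1) → ℝ) i := by
      obtain ⟨f, hf⟩ := LinearMap.exists_extend
        ((Module.Basis.span he).constr ℝ (Pi.single 0 1 : Fin (r + 1) → ℝ))
      refine ⟨f, fun i => ?_⟩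
      have := congr($hf (Module.Basis.span he i))
      rw [Module.Basis.constr_basis] at this
      rw [← this]
      simp [Module.Basis.span_apply]
    obtain ⟨u, hu⟩ := exists_diracPairing_eq f
    have h0 : diracPairing u (e 0) = 1 := by rw [hu, hf]; simp
    have hi : ∀ w ∈ List.ofFn (fun i : Fin r => e i.succ), diracPairing u w = 0 := by
      intro w hw
      obtain ⟨i, rfl⟩ := (List.mem_ofFn' _ _).1 hw
      rw [hu, hf]
      simp
    have hall' : ∀ s, cliffordAct (e 0) ((List.ofFn fun i => e i.succ).foldr cliffordAct s) = 0 := by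
      intro s
      simpa [List.ofFn_succ] using hall s
    have h1 := cliffordAct_cliffordAct_add u (e 0)
      ((List.ofFn fun i => e i.succ).foldr cliffordAct s)
    rw [cliffordAct_foldr_of_diracPairing_eq_zero u _ hi, hall', hall', h0, one_smul,
      ← cliffordEnd_apply, map_zero, add_zero] at h1
    exact hs h1.symm

end Pairing

section LocalCalculus

variable {V : Type*} [NormedAddCommGroup V] [NormedSpace ℝ V]

/-- The derivative of a spinor-valued function in the direction `v`. -/
noncomputable def spinorDeriv (v : V) (Φ : V → Spinor V) (y : V) : Spinor V :=
  fun k => fderiv ℝ (fun z => Φ z k) y v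

/-- The exterior derivative of an inhomogeneous form on the model space. -/
noncomputable def spinorExtDeriv (Φ : V → Spinor V) (y : V) : Spinor V
  | 0 => 0
  | k + 1 => extDeriv (fun z => Φ z k) y

/-- The operator `d + η` on the model space. -/
noncomputable def spinorTwistedD (η : V → V [⋀^Fin 3]→L[ℝ] ℝ) (Φ : V → Spinor V) (y : V) :
    Spinor V :=
  spinorExtDeriv Φ y + threeFormWedge (η y) (Φ y)

/-- Contraction with the vector part, as a bilinear map. -/
noncomputable def contractCLM (k : ℕ) : (V × (V →L[ℝ] ℝ)) →L[ℝ] (V [⋀^Fin (k + 1)]→L[ℝ] ℝ) →L[ℝ]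
    (V [⋀^Fin k]→L[ℝ] ℝ) :=
  (ContinuousAlternatingMap.curryLeftLI (𝕜 := ℝ) (E := V) (F := ℝ)
    (n := k)).toContinuousLinearMap.flip ∘L ContinuousLinearMap.fst ℝ V (V →L[ℝ] ℝ)

/-- Exterior product with the covector part, as a bilinear map. -/
noncomputable def covectorWedgeCLM (k : ℕ) : (V × (V →L[ℝ] ℝ)) →L[ℝ] (V [⋀^Fin k]→L[ℝ] ℝ) →L[ℝ]
    (V [⋀^Fin (k + 1)]→L[ℝ] ℝ) :=
  ContinuousLinearMap.compL ℝ (V [⋀^Fin k]→L[ℝ] ℝ) (V →L[ℝ] V [⋀^Fin k]→L[ℝ] ℝ)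
      (V [⋀^Fin (k + 1)]→L[ℝ] ℝ) (ContinuousAlternatingMap.alternatizeUncurryFinCLM ℝ V ℝ) ∘L
    ContinuousLinearMap.smulRightL ℝ V (V [⋀^Fin k]→L[ℝ] ℝ) ∘L
    ContinuousLinearMap.snd ℝ V (V →L[ℝ] ℝ)

theorem cliffordAct_zero_eq (w : V × (V →L[ℝ] ℝ)) (φ : Spinor V) :
    cliffordAct w φ 0 = contractCLM 0 w (φ 1) := by
  simp [cliffordAct, covectorWedge, contract, contractCLM]

theorem cliffordAct_succ_eq (w : V × (V →L[ℝ] ℝ)) (φ : Spinor V) (k : ℕ) :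
    cliffordAct w φ (k + 1) =
      contractCLM (k + 1) w (φ (k + 2)) + covectorWedgeCLM k w (φ k) := rfl

section Bilinear

variable {E F G : Type*} [NormedAddCommGroup E] [NormedSpace ℝ E] [NormedAddCommGroup F]
  [NormedSpace ℝ F] [NormedAddCommGroup G] [NormedSpace ℝ G]

theorem ContinuousLinearMap.contDiffAt_apply₂ (B : E →L[ℝ] F →L[ℝ] G) {n : ℕ∞ω} {f : V → E}
    {g : V → F} {y : V} (hf : ContDiffAt ℝ n f y) (hg : ContDiffAt ℝ n g y) :
    ContDiffAt ℝ n (fun z => B (f z) (g z)) y :=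
  (B.contDiff.contDiffAt.comp y hf).clm_apply hg

theorem ContinuousLinearMap.differentiableAt_apply₂ (B : E →L[ℝ] F →L[ℝ] G) {f : V → E}
    {g : V → F} {y : V} (hf : DifferentiableAt ℝ f y) (hg : DifferentiableAt ℝ g y) :
    DifferentiableAt ℝ (fun z => B (f z) (g z)) y :=
  (B.hasFDerivAt_of_bilinear hf.hasFDerivAt hg.hasFDerivAt).differentiableAt

theorem ContinuousLinearMap.fderiv_apply₂ (B : E →L[ℝ] F →L[ℝ] G) {f : V → E}
    {g : V → F} {y : V} (hf : DifferentiableAt ℝ f y) (hg : DifferentiableAt ℝ g y) (v : V) :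
    fderiv ℝ (fun z => B (f z) (g z)) y v = B (fderiv ℝ f y v) (g y) + B (f y) (fderiv ℝ g y v) := by
  rw [(B.hasFDerivAt_of_bilinear hf.hasFDerivAt hg.hasFDerivAt).fderiv]
  simp [add_comm]

theorem ContinuousLinearMap.contDiffAt_apply_comp (B : E →L[ℝ] F →L[ℝ] G) {n : ℕ∞ω} {f : V → E}
    {g : V → V →L[ℝ] F} {y : V} (hf : ContDiffAt ℝ n f y) (hg : ContDiffAt ℝ n g y) :
    ContDiffAt ℝ n (fun z => B (f z) ∘L g z) y :=
  (B.contDiff.contDiffAt.comp y hf).clm_comp hg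

end Bilinear

variable {w w₁ w₂ : V → V × (V →L[ℝ] ℝ)} {Φ Ψ : V → Spinor V} {y : V}
  {η : V → V [⋀^Fin 3]→L[ℝ] ℝ}

theorem contDiffAt_cliffordAct {n : ℕ∞ω} (hw : ContDiffAt ℝ n w y)
    (hΦ : ∀ k, ContDiffAt ℝ n (fun z => Φ z k) y) (k : ℕ) :
    ContDiffAt ℝ n (fun z => cliffordAct (w z) (Φ z) k) y := by
  cases k with
  | zero =>
    simp only [cliffordAct_zero_eq]
    have h := (contractCLM 0).contDiffAt_apply₂ hw (hΦ 1)
    exact h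
  | succ k =>
    simp only [cliffordAct_succ_eq]
    have h1 := (contractCLM (k + 1)).contDiffAt_apply₂ hw (hΦ (k + 2))
    have h2 := (covectorWedgeCLM k).contDiffAt_apply₂ hw (hΦ k)
    exact h1.add h2

theorem differentiableAt_cliffordAct (hw : DifferentiableAt ℝ w y)
    (hΦ : ∀ k, DifferentiableAt ℝ (fun z => Φ z k) y) (k : ℕ) :
    DifferentiableAt ℝ (fun z => cliffordAct (w z) (Φ z) k) y := by
  cases k with
  | zero =>
    simp only [cliffordAct_zero_eq]
    have h := (contractCLM 0).differentiableAt_apply₂ hw (hΦ 1)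
    exact h
  | succ k =>
    simp only [cliffordAct_succ_eq]
    have h1 := (contractCLM (k + 1)).differentiableAt_apply₂ hw (hΦ (k + 2))
    have h2 := (covectorWedgeCLM k).differentiableAt_apply₂ hw (hΦ k)
    exact h1.add h2

theorem spinorDeriv_cliffordAct (hw : DifferentiableAt ℝ w y)
    (hΦ : ∀ k, DifferentiableAt ℝ (fun z => Φ z k) y) (v : V) :
    spinorDeriv v (fun z => cliffordAct (w z) (Φ z)) y =
      cliffordAct (fderiv ℝ w y v) (Φ y) + cliffordAct (w y) (spinorDeriv v Φ y) := by
  funext k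
  rw [Pi.add_apply]
  cases k with
  | zero =>
    simp only [spinorDeriv, cliffordAct_zero_eq]
    have h := (contractCLM 0).fderiv_apply₂ hw (hΦ 1) v
    exact h
  | succ k =>
    simp only [spinorDeriv, cliffordAct_succ_eq]
    rw [fderiv_fun_add ((contractCLM (k + 1)).differentiableAt_apply₂ hw (hΦ (k + 2)))
      ((covectorWedgeCLM k).differentiableAt_apply₂ hw (hΦ k)), add_apply,
      (contractCLM (k + 1)).fderiv_apply₂ hw (hΦ (k + 2)),
      (covectorWedgeCLM k).fderiv_apply₂ hw (hΦ k)]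
    abel

theorem contDiffAt_threeFormWedge {n : ℕ∞ω} (hη : ContDiffAt ℝ n η y)
    (hΦ : ∀ k, ContDiffAt ℝ n (fun z => Φ z k) y) (k : ℕ) :
    ContDiffAt ℝ n (fun z => threeFormWedge (η z) (Φ z) k) y := by
  match k with
  | 0 => exact contDiffAt_const
  | 1 => exact contDiffAt_const
  | 2 => exact contDiffAt_const
  | k + 3 =>
    have h := (wedge 3 k).contDiffAt_apply₂ hη (hΦ k)
    exact h

theorem spinorDeriv_threeFormWedge (hη : DifferentiableAt ℝ η y)
    (hΦ : ∀ k, DifferentiableAt ℝ (fun z => Φ z k) y) (v : V) :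
    spinorDeriv v (fun z => threeFormWedge (η z) (Φ z)) y =
      threeFormWedge (fderiv ℝ η y v) (Φ y) + threeFormWedge (η y) (spinorDeriv v Φ y) := by
  funext k
  rw [Pi.add_apply]
  match k with
  | 0 => simp [spinorDeriv, threeFormWedge]
  | 1 => simp [spinorDeriv, threeFormWedge]
  | 2 => simp [spinorDeriv, threeFormWedge]
  | k + 3 =>
    have h := (wedge 3 k).fderiv_apply₂ hη (hΦ k) v
    exact h

theorem contDiffAt_extDeriv {k : ℕ} {a : V → V [⋀^Fin k]→L[ℝ] ℝ} (ha : ContDiffAt ℝ ∞ a y) :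
    ContDiffAt ℝ ∞ (extDeriv a) y := by
  change ContDiffAt ℝ ∞
    (fun z => ContinuousAlternatingMap.alternatizeUncurryFinCLM ℝ V ℝ (fderiv ℝ a z)) y
  exact (ContinuousAlternatingMap.alternatizeUncurryFinCLM ℝ V ℝ).contDiff.contDiffAt.comp y
    (ha.fderiv_right (m := ∞) (by simp))

theorem contDiffAt_spinorExtDeriv (hΦ : ∀ k, ContDiffAt ℝ ∞ (fun z => Φ z k) y) (k : ℕ) :
    ContDiffAt ℝ ∞ (fun z => spinorExtDeriv Φ z k) y := by
  cases k with
  | zero => exact contDiffAt_const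
  | succ k => exact contDiffAt_extDeriv (hΦ k)

theorem contDiffAt_spinorTwistedD (hη : ContDiffAt ℝ ∞ η y)
    (hΦ : ∀ k, ContDiffAt ℝ ∞ (fun z => Φ z k) y) (k : ℕ) :
    ContDiffAt ℝ ∞ (fun z => spinorTwistedD η Φ z k) y :=
  (contDiffAt_spinorExtDeriv hΦ k).add (contDiffAt_threeFormWedge hη hΦ k)

theorem spinorExtDeriv_congr (h : ∀ k, (fun z => Φ z k) =ᶠ[𝓝 y] fun z => Ψ z k) :
    spinorExtDeriv Φ y = spinorExtDeriv Ψ y := by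
  funext k
  cases k with
  | zero => rfl
  | succ k => exact (h k).extDeriv_eq

theorem spinorTwistedD_congr (h : Φ =ᶠ[𝓝 y] Ψ) :
    spinorTwistedD η Φ y = spinorTwistedD η Ψ y := by
  rw [spinorTwistedD, spinorTwistedD, h.eq_of_nhds, spinorExtDeriv_congr]
  exact fun k => h.mono fun z hz => congrFun hz k

theorem spinorExtDeriv_add (hΦ : ∀ k, DifferentiableAt ℝ (fun z => Φ z k) y)
    (hΨ : ∀ k, DifferentiableAt ℝ (fun z => Ψ z k) y) :
    spinorExtDeriv (fun z => Φ z + Ψ z) y = spinorExtDeriv Φ y + spinorExtDeriv Ψ y := by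
  funext k
  cases k with
  | zero => simp [spinorExtDeriv]
  | succ k => exact extDeriv_fun_add (hΦ k) (hΨ k)

theorem spinorExtDeriv_spinorExtDeriv (hΦ : ∀ k, ContDiffAt ℝ ∞ (fun z => Φ z k) y) :
    spinorExtDeriv (spinorExtDeriv Φ) y = 0 := by
  funext k
  match k with
  | 0 => rfl
  | 1 =>
    simp only [spinorExtDeriv, extDeriv, fderiv_fun_const, Pi.zero_apply]
    exact map_zero (ContinuousAlternatingMap.alternatizeUncurryFinCLM ℝ V ℝ)
  | k + 2 =>
    refine extDeriv_extDeriv_apply (hΦ k) ?_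
    rw [minSmoothness_of_isRCLikeNormedField]
    exact WithTop.coe_le_coe.2 le_top

/-- The Courant bracket in coordinates. -/
noncomputable def dorfman (η : V → V [⋀^Fin 3]→L[ℝ] ℝ) (w₁ w₂ : V → V × (V →L[ℝ] ℝ)) (y : V) :
    V × (V →L[ℝ] ℝ) :=
  fderiv ℝ w₂ y (w₁ y).1 - fderiv ℝ w₁ y (w₂ y).1 +
    (0, toCovector (((η y).curryLeft (w₂ y).1).curryLeft (w₁ y).1) -
      diracPairingCLM V (w₁ y) ∘L fderiv ℝ w₂ y)

theorem contDiffAt_dorfman (hη : ContDiffAt ℝ ∞ η y) (hw₁ : ContDiffAt ℝ ∞ w₁ y)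
    (hw₂ : ContDiffAt ℝ ∞ w₂ y) : ContDiffAt ℝ ∞ (dorfman η w₁ w₂) y := by
  have hd {u : V → V × (V →L[ℝ] ℝ)} (hu : ContDiffAt ℝ ∞ u y) : ContDiffAt ℝ ∞ (fderiv ℝ u) y :=
    hu.fderiv_right (m := ∞) (by simp)
  have hι {k : ℕ} {a : V → V [⋀^Fin (k + 1)]→L[ℝ] ℝ} {u : V → V × (V →L[ℝ] ℝ)}
      (ha : ContDiffAt ℝ ∞ a y) (hu : ContDiffAt ℝ ∞ u y) :
      ContDiffAt ℝ ∞ (fun z => (a z).curryLeft (u z).1) y :=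
    (contractCLM k).contDiffAt_apply₂ hu ha
  refine (((hd hw₂).clm_apply hw₁.fst).sub ((hd hw₁).clm_apply hw₂.fst)).add
    (contDiffAt_const.prodMk (ContDiffAt.sub ?_ ?_))
  · exact toCovector.contDiff.contDiffAt.comp y (hι (hι hη hw₂) hw₁)
  · exact (diracPairingCLM V).contDiffAt_apply_comp hw₁ (hd hw₂)

variable [FiniteDimensional ℝ V]

theorem spinorExtDeriv_eq_sum (Φ : V → Spinor V) (y : V) :
    spinorExtDeriv Φ y = ∑ i, covectorEnd (coframe V i) (spinorDeriv (frame V i) Φ y) := by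
  funext k
  rw [Finset.sum_apply]
  cases k with
  | zero => simp [spinorExtDeriv, covectorWedge]
  | succ k =>
    rw [spinorExtDeriv, extDeriv, ← sum_coframe_smulRight (fderiv ℝ (fun z => Φ z k) y),
      ← ContinuousAlternatingMap.alternatizeUncurryFinCLM_apply, map_sum]
    rfl

theorem spinorExtDeriv_threeFormWedge (hη : DifferentiableAt ℝ η y)
    (hΦ : ∀ k, DifferentiableAt ℝ (fun z => Φ z k) y) :
    spinorExtDeriv (fun z => threeFormWedge (η z) (Φ z)) y =
      formEnd 4 (extDeriv η y) (Φ y) - threeFormWedge (η y) (spinorExtDeriv Φ y) := by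
  rw [spinorExtDeriv_eq_sum, spinorExtDeriv_eq_sum, extDeriv, ← sum_covectorEnd_mul_formEnd]
  simp only [spinorDeriv_threeFormWedge hη hΦ]
  simp only [threeFormWedge_eq_formEnd, map_add, map_sum,
    Finset.sum_add_distrib, LinearMap.coe_sum, Finset.sum_apply, Module.End.mul_apply]
  rw [sub_eq_add_neg, ← Finset.sum_neg_distrib]
  refine congrArg _ ?_
  refine Finset.sum_congr rfl fun i _ => ?_
  have h := formEnd_mul_covectorEnd 3 (η y) (coframe V i)
  have h2 := congr($h (spinorDeriv (frame V i) Φ y))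
  rw [Module.End.mul_apply] at h2
  rw [h2]
  norm_num

/-- `(d + η)² = 0` for a closed `3`-form `η`. -/
theorem spinorTwistedD_spinorTwistedD (hη : ContDiffAt ℝ ∞ η y) (hdη : extDeriv η y = 0)
    (hΦ : ∀ k, ContDiffAt ℝ ∞ (fun z => Φ z k) y) :
    spinorTwistedD η (spinorTwistedD η Φ) y = 0 := by
  have hd {F : Type _} [NormedAddCommGroup F] [NormedSpace ℝ F] {f : V → F}
    (hf : ContDiffAt ℝ ∞ f y) : DifferentiableAt ℝ f y := hf.differentiableAt (by simp)
  have h1 : spinorExtDeriv (spinorTwistedD η Φ) y =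
      spinorExtDeriv (spinorExtDeriv Φ) y +
        spinorExtDeriv (fun z => threeFormWedge (η z) (Φ z)) y :=
    spinorExtDeriv_add (fun k => hd (contDiffAt_spinorExtDeriv hΦ k))
      (fun k => hd (contDiffAt_threeFormWedge hη hΦ k))
  rw [spinorTwistedD, h1, spinorExtDeriv_spinorExtDeriv hΦ,
    spinorExtDeriv_threeFormWedge (hd hη) (fun k => hd (hΦ k)), hdη, map_zero]
  have h2 := congr($(formEnd_mul_self_of_odd (p := 3) (by decide) (η y)) (Φ y))
  simp only [threeFormWedge_eq_formEnd, spinorTwistedD, map_add, Module.End.mul_apply] at h2 ⊢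
  rw [h2]
  simp

theorem cliffordEnd_mul_formEnd_succ (p : ℕ) (a : V [⋀^Fin (p + 1)]→L[ℝ] ℝ)
    (w : V × (V →L[ℝ] ℝ)) :
    cliffordEnd w * formEnd (p + 1) a =
      formEnd p (a.curryLeft w.1) + (-1 : ℝ) ^ (p + 1) • (formEnd (p + 1) a * cliffordEnd w) := by
  rw [cliffordEnd_def, add_mul, contractEnd_mul_formEnd_succ, mul_add, formEnd_mul_covectorEnd,
    smul_add, smul_smul, ← mul_pow]
  simp [add_assoc]

theorem cliffordEnd_dorfman (η : V → V [⋀^Fin 3]→L[ℝ] ℝ) (w₁ w₂ : V → V × (V →L[ℝ] ℝ)) (y : V) :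
    cliffordEnd (dorfman η w₁ w₂ y) =
      ∑ i, (coframe V i (w₁ y).1 • cliffordEnd (fderiv ℝ w₂ y (frame V i)) -
        coframe V i (w₂ y).1 • cliffordEnd (fderiv ℝ w₁ y (frame V i)) -
        diracPairing (w₁ y) (fderiv ℝ w₂ y (frame V i)) • covectorEnd (coframe V i)) +
      formEnd 1 (((η y).curryLeft (w₂ y).1).curryLeft (w₁ y).1) := by
  have h1 (v : V) (u : V → V × (V →L[ℝ] ℝ)) : ∑ i, coframe V i v • cliffordEnd (fderiv ℝ u y
      (frame V i)) = cliffordEnd (fderiv ℝ u y v) := by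
    simp only [← map_smul, ← map_sum, sum_coframe_smul]
  have h2 : ∑ i, diracPairing (w₁ y) (fderiv ℝ w₂ y (frame V i)) • covectorEnd (coframe V i) =
      covectorEnd (diracPairingCLM V (w₁ y) ∘L fderiv ℝ w₂ y) := by
    simp only [← map_smul, ← map_sum]
    congr 1
    ext v
    have := sum_coframe_smul_map (diracPairingCLM V (w₁ y) ∘L fderiv ℝ w₂ y).toLinearMap v
    simpa [mul_comm] using this
  rw [Finset.sum_sub_distrib, Finset.sum_sub_distrib, h1, h1, h2, formEnd_one, dorfman, map_add,
    map_sub, ← covectorEnd_eq_cliffordEnd, map_sub]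
  abel

theorem spinorTwistedD_eq (η : V → V [⋀^Fin 3]→L[ℝ] ℝ) (Φ : V → Spinor V) (y : V) :
    spinorTwistedD η Φ y =
      ∑ i, covectorEnd (coframe V i) (spinorDeriv (frame V i) Φ y) + formEnd 3 (η y) (Φ y) := by
  rw [spinorTwistedD, spinorExtDeriv_eq_sum, threeFormWedge_eq_formEnd]

theorem derivedBracket_eq_dorfman (hw₁ : DifferentiableAt ℝ w₁ y) (hw₂ : DifferentiableAt ℝ w₂ y)
    (hΦ : ∀ k, DifferentiableAt ℝ (fun z => Φ z k) y) :
    cliffordAct (w₁ y) (cliffordAct (w₂ y) (spinorTwistedD η Φ y) +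
        spinorTwistedD η (fun z => cliffordAct (w₂ z) (Φ z)) y) -
      (cliffordAct (w₂ y) (spinorTwistedD η (fun z => cliffordAct (w₁ z) (Φ z)) y) +
        spinorTwistedD η (fun z => cliffordAct (w₂ z) (cliffordAct (w₁ z) (Φ z))) y) =
      cliffordAct (dorfman η w₁ w₂ y) (Φ y) := by
  rw [← cliffordEnd_apply (dorfman η w₁ w₂ y), cliffordEnd_dorfman]
  simp only [spinorTwistedD_eq, spinorDeriv_cliffordAct hw₁ hΦ, spinorDeriv_cliffordAct hw₂ hΦ,
    spinorDeriv_cliffordAct hw₂ (differentiableAt_cliffordAct hw₁ hΦ)]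
  simp only [← cliffordEnd_apply]
  have hA : formEnd 1 (((η y).curryLeft (w₂ y).1).curryLeft (w₁ y).1) =
      cliffordEnd (w₁ y) * (cliffordEnd (w₂ y) * formEnd 3 (η y) +
        formEnd 3 (η y) * cliffordEnd (w₂ y)) -
      (cliffordEnd (w₂ y) * formEnd 3 (η y) + formEnd 3 (η y) * cliffordEnd (w₂ y)) *
        cliffordEnd (w₁ y) := by
    have h2 : cliffordEnd (w₂ y) * formEnd 3 (η y) + formEnd 3 (η y) * cliffordEnd (w₂ y) =
        formEnd 2 ((η y).curryLeft (w₂ y).1) := by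
      rw [cliffordEnd_mul_formEnd_succ]; norm_num
    rw [h2, cliffordEnd_mul_formEnd_succ]; norm_num
  have hs (i) : coframe V i (w₁ y).1 • cliffordEnd (fderiv ℝ w₂ y (frame V i)) -
        coframe V i (w₂ y).1 • cliffordEnd (fderiv ℝ w₁ y (frame V i)) -
        diracPairing (w₁ y) (fderiv ℝ w₂ y (frame V i)) • covectorEnd (coframe V i) =
      cliffordEnd (w₁ y) * covectorEnd (coframe V i) * cliffordEnd (fderiv ℝ w₂ y (frame V i)) -
      cliffordEnd (w₂ y) * covectorEnd (coframe V i) * cliffordEnd (fderiv ℝ w₁ y (frame V i)) -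
      covectorEnd (coframe V i) * (cliffordEnd (fderiv ℝ w₂ y (frame V i)) * cliffordEnd (w₁ y) +
        cliffordEnd (w₂ y) * cliffordEnd (fderiv ℝ w₁ y (frame V i))) := by
    have h := cliffordEnd_mul_add_mul (w₁ y) (fderiv ℝ w₂ y (frame V i))
    have h' : covectorEnd (coframe V i) * (cliffordEnd (w₁ y) *
        cliffordEnd (fderiv ℝ w₂ y (frame V i)) + cliffordEnd (fderiv ℝ w₂ y (frame V i)) *
        cliffordEnd (w₁ y)) = diracPairing (w₁ y) (fderiv ℝ w₂ y (frame V i)) •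
          covectorEnd (coframe V i) := by
      rw [h, mul_smul_comm, mul_one]
    rw [← h', cliffordEnd_mul_covectorEnd, cliffordEnd_mul_covectorEnd, sub_mul, sub_mul,
      smul_mul_assoc, smul_mul_assoc, one_mul, one_mul]
    noncomm_ring
  have hsi (i) (s : Spinor V) : cliffordEnd (w₁ y) (cliffordEnd (w₂ y) (covectorEnd (coframe V i) s))
      + cliffordEnd (w₁ y) (covectorEnd (coframe V i) (cliffordEnd (w₂ y) s))
      - cliffordEnd (w₂ y) (covectorEnd (coframe V i) (cliffordEnd (w₁ y) s))
      - covectorEnd (coframe V i) (cliffordEnd (w₂ y) (cliffordEnd (w₁ y) s)) = 0 := by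
    have h : cliffordEnd (w₁ y) * (cliffordEnd (w₂ y) * covectorEnd (coframe V i)) +
        cliffordEnd (w₁ y) * (covectorEnd (coframe V i) * cliffordEnd (w₂ y)) -
        cliffordEnd (w₂ y) * (covectorEnd (coframe V i) * cliffordEnd (w₁ y)) -
        covectorEnd (coframe V i) * (cliffordEnd (w₂ y) * cliffordEnd (w₁ y)) = 0 := by
      rw [cliffordEnd_mul_covectorEnd, ← mul_assoc (cliffordEnd (w₂ y)),
        cliffordEnd_mul_covectorEnd, mul_sub, sub_mul, smul_mul_assoc, mul_smul_comm]
      noncomm_ring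
    exact congr($h s)
  simp only [hs, hA, map_add, map_sum, LinearMap.add_apply, LinearMap.coe_sum, Finset.sum_apply,
    LinearMap.sub_apply, Module.End.mul_apply, Finset.sum_add_distrib, Finset.sum_sub_distrib]
  have := Finset.sum_congr rfl fun i (_ : i ∈ Finset.univ) => hsi i (spinorDeriv (frame V i) Φ y)
  simp only [Finset.sum_add_distrib, Finset.sum_sub_distrib, Finset.sum_const_zero] at this
  rw [← sub_eq_zero, ← this]
  abel

end LocalCalculus

section PullbackSmooth

variable {V : Type*} [NormedAddCommGroup V] [NormedSpace ℝ V]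

theorem contDiff_comp_postcomp_precomp {A B C : Type*} [NormedAddCommGroup A] [NormedSpace ℝ A]
    [NormedAddCommGroup B] [NormedSpace ℝ B] [NormedAddCommGroup C] [NormedSpace ℝ C]
    (f : (V →L[ℝ] A) →L[ℝ] B) (g : C →L[ℝ] (V →L[ℝ] A)) {p : (V →L[ℝ] V) → (A →L[ℝ] A)}
    (hp : ContDiff ℝ ∞ p) :
    ContDiff ℝ ∞ fun L : V →L[ℝ] V => f ∘L ContinuousLinearMap.compL ℝ V A A (p L) ∘L
      (ContinuousLinearMap.compL ℝ V V A).flip L ∘L g :=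
  contDiff_const.clm_comp (((ContinuousLinearMap.contDiff _).comp hp).clm_comp
    ((ContinuousLinearMap.contDiff _).clm_comp contDiff_const))

open ContinuousAlternatingMap in
theorem contDiff_compContinuousLinearMapCLM (k : ℕ) :
    ContDiff ℝ ∞ (fun L : V →L[ℝ] V =>
      (compContinuousLinearMapCLM L :
        (V [⋀^Fin k]→L[ℝ] ℝ) →L[ℝ] (V [⋀^Fin k]→L[ℝ] ℝ))) := by
  induction k with
  | zero =>
    have h (L : V →L[ℝ] V) : (compContinuousLinearMapCLM L :
        (V [⋀^Fin 0]→L[ℝ] ℝ) →L[ℝ] (V [⋀^Fin 0]→L[ℝ] ℝ)) = ContinuousLinearMap.id ℝ _ := by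
      ext a u
      exact congrArg a (Subsingleton.elim _ _)
    simp only [h]
    exact contDiff_const
  | succ k ih =>
    have h (L : V →L[ℝ] V) : (compContinuousLinearMapCLM L :
        (V [⋀^Fin (k + 1)]→L[ℝ] ℝ) →L[ℝ] (V [⋀^Fin (k + 1)]→L[ℝ] ℝ)) =
        (((k : ℝ) + 1)⁻¹ • alternatizeUncurryFinCLM ℝ V ℝ) ∘L
          (ContinuousLinearMap.compL ℝ V (V [⋀^Fin k]→L[ℝ] ℝ) (V [⋀^Fin k]→L[ℝ] ℝ)
            (compContinuousLinearMapCLM L)) ∘L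
          ((ContinuousLinearMap.compL ℝ V V (V [⋀^Fin k]→L[ℝ] ℝ)).flip L) ∘L
          curryLeftLI.toContinuousLinearMap := by
      ext1 a
      have h1 := alternatizeUncurryFin_curryLeft (a.compContinuousLinearMap L)
      have hk : ((k : ℝ) + 1) ≠ 0 := by positivity
      rw [ContinuousLinearMap.comp_apply, _root_.smul_apply, eq_inv_smul_iff₀ hk]
      refine Eq.trans ?_ (h1.symm.trans ?_)
      · ext; simp [add_mul]
      · change _ = alternatizeUncurryFin _
        congr 1
        ext1 v
        exact curryLeft_compContinuousLinearMap a L v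
    simp only [h]
    exact contDiff_comp_postcomp_precomp _ _ ih

theorem contDiffAt_compContinuousLinearMap {k : ℕ} {a : V → V [⋀^Fin k]→L[ℝ] ℝ}
    {L : V → V →L[ℝ] V} {y : V} (ha : ContDiffAt ℝ ∞ a y) (hL : ContDiffAt ℝ ∞ L y) :
    ContDiffAt ℝ ∞ (fun z => (a z).compContinuousLinearMap (L z)) y :=
  ((contDiff_compContinuousLinearMapCLM k).contDiffAt.comp y hL).clm_apply ha

end PullbackSmooth

theorem compContinuousLinearMap_comp {V : Type*} [NormedAddCommGroup V] [NormedSpace ℝ V] {k : ℕ}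
    (a : V [⋀^Fin k]→L[ℝ] ℝ) (L L' : V →L[ℝ] V) :
    (a.compContinuousLinearMap L).compContinuousLinearMap L' =
      a.compContinuousLinearMap (L ∘L L') := rfl

theorem contDiffAt_congr {E F : Type*} [NormedAddCommGroup E] [NormedSpace ℝ E]
    [NormedAddCommGroup F] [NormedSpace ℝ F] {f g : E → F} {x : E} {n : ℕ∞ω}
    (h : f =ᶠ[𝓝 x] g) : ContDiffAt ℝ n f x ↔ ContDiffAt ℝ n g x :=
  ⟨fun hf => hf.congr_of_eventuallyEq h.symm, fun hg => hg.congr_of_eventuallyEq h⟩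

section Charts

variable {V : Type*} [NormedAddCommGroup V] [NormedSpace ℝ V]
  {M : Type*} [TopologicalSpace M] [ChartedSpace V M]

/-- The derivative of the chart around `x₀`. -/
noncomputable def chartDeriv (x₀ x : M) : V →L[ℝ] V :=
  mfderiv 𝓘(ℝ, V) 𝓘(ℝ, V) (extChartAt 𝓘(ℝ, V) x₀) x

/-- The derivative of the inverse of the chart around `x₀`. -/
noncomputable def chartSymmDeriv (x₀ : M) (y : V) : V →L[ℝ] V :=
  mfderiv 𝓘(ℝ, V) 𝓘(ℝ, V) (extChartAt 𝓘(ℝ, V) x₀).symm y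

/-- The transformation of `V ⊕ V*` induced by linear maps on vectors and, dually, on covectors. -/
noncomputable def genMap (B A : V →L[ℝ] V) (u : V × (V →L[ℝ] ℝ)) : V × (V →L[ℝ] ℝ) :=
  (B u.1, u.2 ∘L A)

theorem genMap_genMap (B A B' A' : V →L[ℝ] V) (u : V × (V →L[ℝ] ℝ)) :
    genMap B A (genMap B' A' u) = genMap (B ∘L B') (A' ∘L A) u := rfl

theorem genMap_id (u : V × (V →L[ℝ] ℝ)) :
    genMap (ContinuousLinearMap.id ℝ V) (ContinuousLinearMap.id ℝ V) u = u := rfl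

/-- The value of a section of `𝕋M`, as an element of `V ⊕ V*`. -/
def GenField.toModel (w : GenField V M) (x : M) : V × (V →L[ℝ] ℝ) := w x

/-- The value of a form, as a form on `V`. -/
def FormField.toModel {k : ℕ} (a : FormField V M k) (x : M) : V [⋀^Fin k]→L[ℝ] ℝ := a x

/-- The value of an inhomogeneous form, as a form on `V`. -/
def SpinorField.toModel (φ : SpinorField V M) (x : M) : Spinor V := φ x

/-- A section of `𝕋M` read in the chart around `x₀`. -/
noncomputable def GenField.inChart (w : GenField V M) (x₀ : M) (y : V) : V × (V →L[ℝ] ℝ) :=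
  genMap (chartDeriv x₀ ((extChartAt 𝓘(ℝ, V) x₀).symm y)) (chartSymmDeriv x₀ y)
    (w.toModel ((extChartAt 𝓘(ℝ, V) x₀).symm y))

/-- An inhomogeneous form read in the chart around `x₀`. -/
noncomputable def SpinorField.inChart (φ : SpinorField V M) (x₀ : M) (y : V) : Spinor V :=
  fun k => FormField.inChart (fun x => φ x k) x₀ y

theorem SpinorField.inChart_eq_pullback (φ : SpinorField V M) (x₀ : M) (y : V) :
    φ.inChart x₀ y =
      Spinor.pullback (chartSymmDeriv x₀ y) (φ.toModel ((extChartAt 𝓘(ℝ, V) x₀).symm y)) := rfl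

theorem FormField.inChart_eq {k : ℕ} (a : FormField V M k) (x₀ : M) (y : V) :
    a.inChart x₀ y = (a.toModel ((extChartAt 𝓘(ℝ, V) x₀).symm y)).compContinuousLinearMap
      (chartSymmDeriv x₀ y) := rfl

/-- The change of charts. -/
noncomputable def chartChange (x₀ x₁ : M) (y : V) : V :=
  extChartAt 𝓘(ℝ, V) x₁ ((extChartAt 𝓘(ℝ, V) x₀).symm y)

variable (V) in
/-- The domain of the change of charts. -/
def chartChangeSource (x₀ x₁ : M) : Set V :=
  (extChartAt 𝓘(ℝ, V) x₀).target ∩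
    (extChartAt 𝓘(ℝ, V) x₀).symm ⁻¹' (extChartAt 𝓘(ℝ, V) x₁).source

theorem isOpen_chartChangeSource (x₀ x₁ : M) : IsOpen (chartChangeSource V x₀ x₁) :=
  (continuousOn_extChartAt_symm x₀).isOpen_inter_preimage (isOpen_extChartAt_target x₀)
    (isOpen_extChartAt_source x₁)

theorem chartChange_mem {x₀ x₁ : M} {y : V} (hy : y ∈ chartChangeSource V x₀ x₁) :
    chartChange x₀ x₁ y ∈ chartChangeSource V x₁ x₀ := by
  refine ⟨(extChartAt 𝓘(ℝ, V) x₁).map_source hy.2, ?_⟩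
  rw [chartChange, Set.mem_preimage, (extChartAt 𝓘(ℝ, V) x₁).left_inv hy.2]
  exact (extChartAt 𝓘(ℝ, V) x₀).map_target hy.1

theorem symm_chartChange {x₀ x₁ : M} {y : V} (hy : y ∈ chartChangeSource V x₀ x₁) :
    (extChartAt 𝓘(ℝ, V) x₁).symm (chartChange x₀ x₁ y) = (extChartAt 𝓘(ℝ, V) x₀).symm y :=
  (extChartAt 𝓘(ℝ, V) x₁).left_inv hy.2

theorem contMDiffAt_iff_contDiffAt_comp_symm {F : Type*} [NormedAddCommGroup F] [NormedSpace ℝ F]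
    {f : M → F} {x : M} : ContMDiffAt 𝓘(ℝ, V) 𝓘(ℝ, F) ∞ f x ↔
      ContDiffAt ℝ ∞ (fun z => f ((extChartAt 𝓘(ℝ, V) x).symm z)) (extChartAt 𝓘(ℝ, V) x x) := by
  rw [contMDiffAt_iff_source, modelWithCornersSelf_coe, Set.range_id, contMDiffWithinAt_univ,
    contMDiffAt_iff_contDiffAt]
  rfl

variable [IsManifold 𝓘(ℝ, V) ∞ M]

theorem chartSymmDeriv_comp_chartDeriv {x₀ : M} {y : V} (hy : y ∈ (extChartAt 𝓘(ℝ, V) x₀).target) :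
    chartSymmDeriv x₀ y ∘L chartDeriv x₀ ((extChartAt 𝓘(ℝ, V) x₀).symm y) =
      ContinuousLinearMap.id ℝ V := by
  have h := mfderivWithin_extChartAt_symm_comp_mfderiv_extChartAt (I := 𝓘(ℝ, V)) hy
  rw [modelWithCornersSelf_coe, Set.range_id, mfderivWithin_univ] at h
  exact h

theorem chartDeriv_comp_chartSymmDeriv {x₀ : M} {y : V} (hy : y ∈ (extChartAt 𝓘(ℝ, V) x₀).target) :
    chartDeriv x₀ ((extChartAt 𝓘(ℝ, V) x₀).symm y) ∘L chartSymmDeriv x₀ y =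
      ContinuousLinearMap.id ℝ V := by
  have h := mfderiv_extChartAt_comp_mfderivWithin_extChartAt_symm (I := 𝓘(ℝ, V)) hy
  rw [modelWithCornersSelf_coe, Set.range_id, mfderivWithin_univ] at h
  exact h

theorem chartDeriv_self (x : M) : chartDeriv x x = ContinuousLinearMap.id ℝ V :=
  mfderiv_extChartAt_self

theorem chartSymmDeriv_self (x : M) :
    chartSymmDeriv x (extChartAt 𝓘(ℝ, V) x x) = ContinuousLinearMap.id ℝ V := by
  have h := chartSymmDeriv_comp_chartDeriv (mem_extChartAt_target (I := 𝓘(ℝ, V)) x)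
  rwa [extChartAt_to_inv, chartDeriv_self, ContinuousLinearMap.comp_id] at h

theorem contDiffAt_chartChange {x₀ x₁ : M} {y : V} (hy : y ∈ chartChangeSource V x₀ x₁) :
    ContDiffAt ℝ ∞ (chartChange x₀ x₁ : V → V) y := by
  have h := contDiffWithinAt_ext_coord_change (I := 𝓘(ℝ, V)) (n := ∞) x₁ x₀ (y := y)
    (by rw [PartialEquiv.trans_source]; exact ⟨hy.1, hy.2⟩)
  rw [modelWithCornersSelf_coe, Set.range_id, contDiffWithinAt_univ] at h
  exact h

theorem fderiv_chartChange {x₀ x₁ : M} {y : V} (hy : y ∈ chartChangeSource V x₀ x₁) :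
    fderiv ℝ (chartChange x₀ x₁) y =
      chartDeriv x₁ ((extChartAt 𝓘(ℝ, V) x₀).symm y) ∘L chartSymmDeriv x₀ y := by
  have h1 : MDifferentiableAt 𝓘(ℝ, V) 𝓘(ℝ, V) (extChartAt 𝓘(ℝ, V) x₁)
      ((extChartAt 𝓘(ℝ, V) x₀).symm y) :=
    mdifferentiableAt_extChartAt (by simpa [extChartAt_source] using hy.2)
  have h2 : MDifferentiableAt 𝓘(ℝ, V) 𝓘(ℝ, V) (extChartAt 𝓘(ℝ, V) x₀).symm y := by
    have := mdifferentiableWithinAt_extChartAt_symm (I := 𝓘(ℝ, V)) hy.1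
    rwa [modelWithCornersSelf_coe, Set.range_id, mdifferentiableWithinAt_univ] at this
  have := mfderiv_comp y h1 h2
  rw [← mfderiv_eq_fderiv]
  exact this

theorem FormField.inChart_chartChange {k : ℕ} (a : FormField V M k) {x₀ x₁ : M} {y : V}
    (hy : y ∈ chartChangeSource V x₀ x₁) :
    a.inChart x₀ y = (a.inChart x₁ (chartChange x₀ x₁ y)).compContinuousLinearMap
      (fderiv ℝ (chartChange x₀ x₁) y) := by
  have h := chartSymmDeriv_comp_chartDeriv (chartChange_mem hy).1
  rw [symm_chartChange hy] at h
  rw [FormField.inChart_eq, FormField.inChart_eq, fderiv_chartChange hy, symm_chartChange hy]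
  refine Eq.trans ?_ (compContinuousLinearMap_comp _ _ _).symm
  rw [← ContinuousLinearMap.comp_assoc, h, ContinuousLinearMap.id_comp]

theorem GenField.inChart_chartChange (w : GenField V M) {x₀ x₁ : M} {y : V}
    (hy : y ∈ chartChangeSource V x₀ x₁) :
    w.inChart x₀ y = genMap (fderiv ℝ (chartChange x₁ x₀) (chartChange x₀ x₁ y))
      (fderiv ℝ (chartChange x₀ x₁) y) (w.inChart x₁ (chartChange x₀ x₁ y)) := by
  have h := chartSymmDeriv_comp_chartDeriv (chartChange_mem hy).1
  rw [symm_chartChange hy] at h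
  rw [fderiv_chartChange hy, fderiv_chartChange (chartChange_mem hy), GenField.inChart,
    GenField.inChart, genMap_genMap, symm_chartChange hy, ContinuousLinearMap.comp_assoc, h,
    ← ContinuousLinearMap.comp_assoc, h, ContinuousLinearMap.id_comp, ContinuousLinearMap.comp_id]

theorem FormField.contDiffAt_inChart_of_inChart {k : ℕ} {a : FormField V M k} {x₀ x₁ : M} {y : V}
    (hy : y ∈ chartChangeSource V x₀ x₁)
    (ha : ContDiffAt ℝ ∞ (a.inChart x₁) (chartChange x₀ x₁ y)) : ContDiffAt ℝ ∞ (a.inChart x₀) y := by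
  have hτ := contDiffAt_chartChange hy
  refine (contDiffAt_compContinuousLinearMap (ha.comp y hτ)
    (hτ.fderiv_right (m := ∞) (by simp))).congr_of_eventuallyEq ?_
  filter_upwards [(isOpen_chartChangeSource x₀ x₁).mem_nhds hy] with z hz
  exact a.inChart_chartChange hz

theorem GenField.contDiffAt_inChart_of_inChart {w : GenField V M} {x₀ x₁ : M} {y : V}
    (hy : y ∈ chartChangeSource V x₀ x₁)
    (hw : ContDiffAt ℝ ∞ (w.inChart x₁) (chartChange x₀ x₁ y)) :
    ContDiffAt ℝ ∞ (w.inChart x₀) y := by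
  have hτ := contDiffAt_chartChange hy
  have hτ' := contDiffAt_chartChange (chartChange_mem hy)
  have hw' : ContDiffAt ℝ ∞ (fun z => w.inChart x₁ (chartChange x₀ x₁ z)) y := hw.comp y hτ
  have hf : ContDiffAt ℝ ∞ (fun z => fderiv ℝ (chartChange x₁ x₀) (chartChange x₀ x₁ z)) y :=
    ContDiffAt.comp y (hτ'.fderiv_right (m := ∞) (by simp)) hτ
  refine ContDiffAt.congr_of_eventuallyEq ((hf.clm_apply hw'.fst).prodMk
    (hw'.snd.clm_comp (hτ.fderiv_right (m := ∞) (by simp)))) ?_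
  filter_upwards [(isOpen_chartChangeSource x₀ x₁).mem_nhds hy] with z hz
  exact w.inChart_chartChange hz

theorem symmL_trivializationAt_eq {x₀ : M} {y : V} (hy : y ∈ (extChartAt 𝓘(ℝ, V) x₀).target) :
    (trivializationAt V (TangentSpace 𝓘(ℝ, V)) x₀).symmL ℝ ((extChartAt 𝓘(ℝ, V) x₀).symm y) =
      chartSymmDeriv x₀ y := by
  have hx : (extChartAt 𝓘(ℝ, V) x₀).symm y ∈ (chartAt V x₀).source := by
    simpa [extChartAt_source] using (extChartAt 𝓘(ℝ, V) x₀).map_target hy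
  rw [TangentBundle.symmL_trivializationAt hx, modelWithCornersSelf_coe, Set.range_id,
    mfderivWithin_univ, (extChartAt 𝓘(ℝ, V) x₀).right_inv hy]
  rfl

theorem continuousLinearMapAt_trivializationAt_eq {x₀ : M} {y : V}
    (hy : y ∈ (extChartAt 𝓘(ℝ, V) x₀).target) :
    (trivializationAt V (TangentSpace 𝓘(ℝ, V)) x₀).continuousLinearMapAt ℝ
      ((extChartAt 𝓘(ℝ, V) x₀).symm y) =
      chartDeriv (V := V) x₀ ((extChartAt 𝓘(ℝ, V) x₀).symm y) := by
  have hx : (extChartAt 𝓘(ℝ, V) x₀).symm y ∈ (chartAt V x₀).source := by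
    simpa [extChartAt_source] using (extChartAt 𝓘(ℝ, V) x₀).map_target hy
  exact TangentBundle.continuousLinearMapAt_trivializationAt hx

theorem continuousLinearMapAt_trivializationAt_trivial (x z : M) :
    (trivializationAt ℝ (Trivial M ℝ) x).continuousLinearMapAt ℝ z = ContinuousLinearMap.id ℝ ℝ :=
  Bundle.Trivial.continuousLinearMapAt_trivialization ℝ M ℝ z

theorem FormField.contMDiffAt_iff {k : ℕ} {a : FormField V M k} {x : M} :
    ContMDiffAt 𝓘(ℝ, V) (𝓘(ℝ, V).prod 𝓘(ℝ, V [⋀^Fin k]→L[ℝ] ℝ)) ∞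
      (fun x => TotalSpace.mk' (V [⋀^Fin k]→L[ℝ] ℝ)
      (E := fun x : M => TangentSpace 𝓘(ℝ, V) x [⋀^Fin k]→L[ℝ] Trivial M ℝ x) x (a x)) x ↔
    ContDiffAt ℝ ∞ (a.inChart x) (extChartAt 𝓘(ℝ, V) x x) := by
  rw [contMDiffAt_section, contMDiffAt_iff_contDiffAt_comp_symm]
  refine contDiffAt_congr ?_
  filter_upwards [(isOpen_extChartAt_target x).mem_nhds (mem_extChartAt_target (I := 𝓘(ℝ, V)) x)]
    with z hz
  rw [FormField.inChart_eq, ← symmL_trivializationAt_eq hz]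
  ext v
  rw [FiberBundle.trivializationAt_continuousAlternatingMap_apply]
  simp only [ContinuousAlternatingMap.inCoordinates]
  rw [continuousLinearMapAt_trivializationAt_trivial]
  rfl

theorem GenField.contMDiffAt_iff {w : GenField V M} {x : M} :
    (ContMDiffAt 𝓘(ℝ, V) (𝓘(ℝ, V).prod 𝓘(ℝ, V)) ∞
      (fun x => TotalSpace.mk' V (E := fun x : M => TangentSpace 𝓘(ℝ, V) x) x (w x).1) x ∧
    ContMDiffAt 𝓘(ℝ, V) (𝓘(ℝ, V).prod 𝓘(ℝ, V →L[ℝ] ℝ)) ∞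
      (fun x => TotalSpace.mk' (V →L[ℝ] ℝ)
        (E := fun x : M => TangentSpace 𝓘(ℝ, V) x →L[ℝ] Trivial M ℝ x) x (w x).2) x) ↔
    ContDiffAt ℝ ∞ (w.inChart x) (extChartAt 𝓘(ℝ, V) x x) := by
  rw [contMDiffAt_section, contMDiffAt_section, contMDiffAt_iff_contDiffAt_comp_symm,
    contMDiffAt_iff_contDiffAt_comp_symm]
  have ht := (isOpen_extChartAt_target x).mem_nhds (mem_extChartAt_target (I := 𝓘(ℝ, V)) x)
  refine Iff.trans (and_congr (contDiffAt_congr (g := fun z => (w.inChart x z).1)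
    ?_) (contDiffAt_congr (g := fun z => (w.inChart x z).2) ?_))
    ⟨fun h => h.1.prodMk h.2, fun h => ⟨h.fst, h.snd⟩⟩
  · filter_upwards [ht] with z hz
    have hx : (extChartAt 𝓘(ℝ, V) x).symm z ∈
        (trivializationAt V (TangentSpace 𝓘(ℝ, V)) x).baseSet := by
      simpa [extChartAt_source] using (extChartAt 𝓘(ℝ, V) x).map_target hz
    change _ = chartDeriv (V := V) x ((extChartAt 𝓘(ℝ, V) x).symm z) (w.toModel _).1
    rw [← continuousLinearMapAt_trivializationAt_eq hz]
    exact (Trivialization.continuousLinearMapAt_apply_of_mem ℝ _ hx _).symm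
  · filter_upwards [ht] with z hz
    change _ = (w.toModel _).2 ∘L chartSymmDeriv x z
    rw [← symmL_trivializationAt_eq hz, hom_trivializationAt_apply]
    simp only [ContinuousLinearMap.inCoordinates]
    rw [continuousLinearMapAt_trivializationAt_trivial]
    rfl

end Charts

section Operators

variable {V : Type*} [NormedAddCommGroup V] [NormedSpace ℝ V]
  {M : Type*} [TopologicalSpace M] [ChartedSpace V M]

variable (V) in
/-- The part of a subset of `M` lying in a chart domain, read in the chart. -/
def chartPreimage (U : Set M) (x₀ : M) : Set V :=
  (extChartAt 𝓘(ℝ, V) x₀).target ∩ (extChartAt 𝓘(ℝ, V) x₀).symm ⁻¹' U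

theorem isOpen_chartPreimage {U : Set M} (hU : IsOpen U) (x₀ : M) :
    IsOpen (chartPreimage V U x₀) :=
  (continuousOn_extChartAt_symm x₀).isOpen_inter_preimage (isOpen_extChartAt_target x₀) hU

theorem extChartAt_mem_chartPreimage {U : Set M} {x₀ x : M}
    (hx₀ : x ∈ (extChartAt 𝓘(ℝ, V) x₀).source) (hx : x ∈ U) :
    extChartAt 𝓘(ℝ, V) x₀ x ∈ chartPreimage V U x₀ := by
  refine ⟨(extChartAt 𝓘(ℝ, V) x₀).map_source hx₀, ?_⟩
  rwa [Set.mem_preimage, (extChartAt 𝓘(ℝ, V) x₀).left_inv hx₀]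

theorem extChartAt_self_mem_chartPreimage {U : Set M} {x : M} (hx : x ∈ U) :
    extChartAt 𝓘(ℝ, V) x x ∈ chartPreimage V U x :=
  extChartAt_mem_chartPreimage (mem_extChartAt_source x) hx

theorem inChart_wedgeThreeForm (η : FormField V M 3) (φ : SpinorField V M) (x₀ : M) (y : V) :
    (wedgeThreeForm η φ).inChart x₀ y = threeFormWedge (η.inChart x₀ y) (φ.inChart x₀ y) := by
  rw [SpinorField.inChart_eq_pullback, SpinorField.inChart_eq_pullback, FormField.inChart_eq,
    threeFormWedge_pullback]
  rfl

variable [IsManifold 𝓘(ℝ, V) ∞ M]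

theorem GenField.inChart_self (w : GenField V M) (x : M) :
    w.inChart x (extChartAt 𝓘(ℝ, V) x x) = w.toModel x := by
  rw [GenField.inChart, extChartAt_to_inv, chartDeriv_self, chartSymmDeriv_self, genMap_id]

theorem SpinorField.inChart_self (φ : SpinorField V M) (x : M) :
    φ.inChart x (extChartAt 𝓘(ℝ, V) x x) = φ.toModel x := by
  rw [SpinorField.inChart_eq_pullback, extChartAt_to_inv, chartSymmDeriv_self]
  rfl

theorem SpinorField.ext_inChart {φ ψ : SpinorField V M} {x : M}
    (h : φ.inChart x (extChartAt 𝓘(ℝ, V) x x) = ψ.inChart x (extChartAt 𝓘(ℝ, V) x x)) :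
    φ x = ψ x := by
  rw [SpinorField.inChart_self, SpinorField.inChart_self] at h
  exact h

theorem GenField.ext_inChart {w w' : GenField V M} {x : M}
    (h : w.inChart x (extChartAt 𝓘(ℝ, V) x x) = w'.inChart x (extChartAt 𝓘(ℝ, V) x x)) :
    w x = w' x := by
  rw [GenField.inChart_self, GenField.inChart_self] at h
  exact h

section Smooth

variable {U : Set M}

theorem FormField.smoothOn_of_inChart {k : ℕ} {a : FormField V M k}
    (h : ∀ x ∈ U, ∃ x₀, x ∈ (extChartAt 𝓘(ℝ, V) x₀).source ∧
      ContDiffAt ℝ ∞ (a.inChart x₀) (extChartAt 𝓘(ℝ, V) x₀ x)) : a.SmoothOn U := by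
  intro x hx
  obtain ⟨x₀, hx₀, ha⟩ := h x hx
  refine ContMDiffAt.contMDiffWithinAt (FormField.contMDiffAt_iff.2 ?_)
  have hy : extChartAt 𝓘(ℝ, V) x x ∈ chartChangeSource V x x₀ :=
    extChartAt_self_mem_chartPreimage hx₀
  refine FormField.contDiffAt_inChart_of_inChart hy ?_
  rwa [chartChange, extChartAt_to_inv]

theorem FormField.SmoothOn.contDiffAt {k : ℕ} {a : FormField V M k} (h : a.SmoothOn U)
    (hU : IsOpen U) {x₀ : M} {y : V} (hy : y ∈ chartPreimage V U x₀) :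
    ContDiffAt ℝ ∞ (a.inChart x₀) y := by
  have hy' : y ∈ chartChangeSource V x₀ ((extChartAt 𝓘(ℝ, V) x₀).symm y) :=
    ⟨hy.1, mem_extChartAt_source _⟩
  exact FormField.contDiffAt_inChart_of_inChart hy'
    (FormField.contMDiffAt_iff.1 ((h _ hy.2).contMDiffAt (hU.mem_nhds hy.2)))

theorem GenField.smoothOn_of_inChart {w : GenField V M}
    (h : ∀ x ∈ U, ∃ x₀, x ∈ (extChartAt 𝓘(ℝ, V) x₀).source ∧
      ContDiffAt ℝ ∞ (w.inChart x₀) (extChartAt 𝓘(ℝ, V) x₀ x)) : w.SmoothOn U := by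
  have key : ∀ x ∈ U, ContDiffAt ℝ ∞ (w.inChart x) (extChartAt 𝓘(ℝ, V) x x) := by
    intro x hx
    obtain ⟨x₀, hx₀, ha⟩ := h x hx
    have hy : extChartAt 𝓘(ℝ, V) x x ∈ chartChangeSource V x x₀ :=
      extChartAt_self_mem_chartPreimage hx₀
    refine GenField.contDiffAt_inChart_of_inChart hy ?_
    rwa [chartChange, extChartAt_to_inv]
  exact ⟨fun x hx => (GenField.contMDiffAt_iff.2 (key x hx)).1.contMDiffWithinAt,
    fun x hx => (GenField.contMDiffAt_iff.2 (key x hx)).2.contMDiffWithinAt⟩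

theorem GenField.SmoothOn.contDiffAt {w : GenField V M} (h : w.SmoothOn U)
    (hU : IsOpen U) {x₀ : M} {y : V} (hy : y ∈ chartPreimage V U x₀) :
    ContDiffAt ℝ ∞ (w.inChart x₀) y := by
  have hy' : y ∈ chartChangeSource V x₀ ((extChartAt 𝓘(ℝ, V) x₀).symm y) :=
    ⟨hy.1, mem_extChartAt_source _⟩
  exact GenField.contDiffAt_inChart_of_inChart hy'
    (GenField.contMDiffAt_iff.1 ⟨(h.1 _ hy.2).contMDiffAt (hU.mem_nhds hy.2),
      (h.2 _ hy.2).contMDiffAt (hU.mem_nhds hy.2)⟩)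

theorem SpinorField.smoothOn_of_inChart {φ : SpinorField V M}
    (h : ∀ x ∈ U, ∃ x₀, x ∈ (extChartAt 𝓘(ℝ, V) x₀).source ∧
      ∀ k, ContDiffAt ℝ ∞ (fun z => φ.inChart x₀ z k) (extChartAt 𝓘(ℝ, V) x₀ x)) :
    φ.SmoothOn U :=
  fun k => FormField.smoothOn_of_inChart fun x hx =>
    (h x hx).imp fun _ h' => ⟨h'.1, h'.2 k⟩

theorem SpinorField.SmoothOn.contDiffAt {φ : SpinorField V M} (h : φ.SmoothOn U)
    (hU : IsOpen U) {x₀ : M} {y : V} (hy : y ∈ chartPreimage V U x₀) (k : ℕ) :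
    ContDiffAt ℝ ∞ (fun z => φ.inChart x₀ z k) y :=
  FormField.SmoothOn.contDiffAt (h k) hU hy

theorem SpinorField.smoothOn_of_inChart_self {φ : SpinorField V M}
    (h : ∀ x ∈ U, ∀ k, ContDiffAt ℝ ∞ (fun z => φ.inChart x z k) (extChartAt 𝓘(ℝ, V) x x)) :
    φ.SmoothOn U :=
  SpinorField.smoothOn_of_inChart fun x hx => ⟨x, mem_extChartAt_source x, h x hx⟩

theorem GenField.smoothOn_of_inChart_self {w : GenField V M}
    (h : ∀ x ∈ U, ContDiffAt ℝ ∞ (w.inChart x) (extChartAt 𝓘(ℝ, V) x x)) : w.SmoothOn U :=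
  GenField.smoothOn_of_inChart fun x hx => ⟨x, mem_extChartAt_source x, h x hx⟩

theorem GenField.SmoothOn.mono {w : GenField V M} {U' : Set M} (h : w.SmoothOn U) (hU : U' ⊆ U) :
    w.SmoothOn U' := ⟨h.1.mono hU, h.2.mono hU⟩

theorem SpinorField.SmoothOn.mono {φ : SpinorField V M} {U' : Set M} (h : φ.SmoothOn U)
    (hU : U' ⊆ U) : φ.SmoothOn U' := fun k => ContMDiffOn.mono (h k) hU

end Smooth

theorem inChart_rho (w : GenField V M) (φ : SpinorField V M) {x₀ : M} {y : V}
    (hy : y ∈ (extChartAt 𝓘(ℝ, V) x₀).target) :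
    (rho w φ).inChart x₀ y = cliffordAct (w.inChart x₀ y) (φ.inChart x₀ y) := by
  rw [SpinorField.inChart_eq_pullback, SpinorField.inChart_eq_pullback, GenField.inChart, genMap,
    cliffordAct_pullback, ← ContinuousLinearMap.comp_apply, chartSymmDeriv_comp_chartDeriv hy]
  rfl

theorem FormField.SmoothOn.inChart_extDeriv {k : ℕ} {a : FormField V M k} {U : Set M}
    (ha : a.SmoothOn U) (hU : IsOpen U) {x₀ : M} {y : V} (hy : y ∈ chartPreimage V U x₀) :
    a.extDeriv.inChart x₀ y = _root_.extDeriv (a.inChart x₀) y := by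
  obtain ⟨x, hx⟩ : ∃ x, x = (extChartAt 𝓘(ℝ, V) x₀).symm y := ⟨_, rfl⟩
  have hy' : y ∈ chartChangeSource V x₀ x := ⟨hy.1, hx ▸ mem_extChartAt_source _⟩
  have hyx : chartChange x₀ x y = extChartAt 𝓘(ℝ, V) x x := by rw [chartChange, ← hx]
  have h1 : a.inChart x₀ =ᶠ[𝓝 y] fun z =>
      (a.inChart x (chartChange x₀ x z)).compContinuousLinearMap
        (fderiv ℝ (chartChange x₀ x) z) := by
    filter_upwards [(isOpen_chartChangeSource x₀ x).mem_nhds hy'] with z hz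
    exact a.inChart_chartChange hz
  have hd : DifferentiableAt ℝ (a.inChart x) (chartChange x₀ x y) := by
    rw [hyx]
    exact (ha.contDiffAt hU (extChartAt_self_mem_chartPreimage (hx ▸ hy.2))).differentiableAt
      (by simp)
  rw [h1.extDeriv_eq, extDeriv_pullback hd (contDiffAt_chartChange hy')
      (by rw [minSmoothness_of_isRCLikeNormedField]; exact WithTop.coe_le_coe.2 (le_top : (2 : ℕ∞) ≤ ⊤)), hyx,
    fderiv_chartChange hy', ← hx, FormField.inChart_eq, ← hx]
  rfl

theorem SpinorField.SmoothOn.inChart_extDeriv {φ : SpinorField V M} {U : Set M}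
    (hφ : φ.SmoothOn U) (hU : IsOpen U) {x₀ : M} {y : V} (hy : y ∈ chartPreimage V U x₀) :
    φ.extDeriv.inChart x₀ y = spinorExtDeriv (φ.inChart x₀) y := by
  funext k
  cases k with
  | zero => exact ContinuousAlternatingMap.ext fun _ => rfl
  | succ k => exact FormField.SmoothOn.inChart_extDeriv (hφ k) hU hy

theorem SpinorField.SmoothOn.inChart_twistedD {η : FormField V M 3} {φ : SpinorField V M}
    {U : Set M} (hφ : φ.SmoothOn U) (hU : IsOpen U) {x₀ : M} {y : V}
    (hy : y ∈ chartPreimage V U x₀) :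
    (twistedD η φ).inChart x₀ y = spinorTwistedD (η.inChart x₀) (φ.inChart x₀) y := by
  rw [spinorTwistedD, ← hφ.inChart_extDeriv hU hy, ← inChart_wedgeThreeForm]
  rfl

theorem SpinorField.SmoothOn.rho {w : GenField V M} {φ : SpinorField V M} {U : Set M}
    (hU : IsOpen U) (hw : w.SmoothOn U) (hφ : φ.SmoothOn U) : (rho w φ).SmoothOn U := by
  refine SpinorField.smoothOn_of_inChart_self fun x hx k => ?_
  have hy := extChartAt_self_mem_chartPreimage (V := V) hx
  refine (contDiffAt_cliffordAct (hw.contDiffAt hU hy) (hφ.contDiffAt hU hy)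
    k).congr_of_eventuallyEq ?_
  filter_upwards [(isOpen_chartPreimage hU x).mem_nhds hy] with z hz
  rw [inChart_rho w φ hz.1]

theorem SpinorField.SmoothOn.twistedD {η : FormField V M 3} {φ : SpinorField V M} {U : Set M}
    (hU : IsOpen U) (hη : η.SmoothOn U) (hφ : φ.SmoothOn U) : (twistedD η φ).SmoothOn U := by
  refine SpinorField.smoothOn_of_inChart_self fun x hx k => ?_
  have hy := extChartAt_self_mem_chartPreimage (V := V) hx
  refine (contDiffAt_spinorTwistedD (hη.contDiffAt hU hy) (hφ.contDiffAt hU hy)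
    k).congr_of_eventuallyEq ?_
  filter_upwards [(isOpen_chartPreimage hU x).mem_nhds hy] with z hz
  rw [hφ.inChart_twistedD hU hz]

/-- `d + η` is a local operator. -/
theorem twistedD_congr {η : FormField V M 3} {φ ψ : SpinorField V M} {U : Set M}
    (hφ : φ.SmoothOn U) (hψ : ψ.SmoothOn U) (hU : IsOpen U) (h : ∀ x ∈ U, φ x = ψ x) {x : M}
    (hx : x ∈ U) : twistedD η φ x = twistedD η ψ x := by
  have hy := extChartAt_self_mem_chartPreimage (V := V) hx
  refine SpinorField.ext_inChart ?_
  rw [hφ.inChart_twistedD hU hy, hψ.inChart_twistedD hU hy]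
  refine spinorTwistedD_congr ?_
  filter_upwards [(isOpen_chartPreimage hU x).mem_nhds hy] with z hz
  rw [SpinorField.inChart_eq_pullback, SpinorField.inChart_eq_pullback]
  exact congrArg _ (h _ hz.2)

theorem twistedD_twistedD [FiniteDimensional ℝ V] {η : FormField V M 3} (hη : η.SmoothOn Set.univ)
    (hdη : η.extDeriv = 0)
    {φ : SpinorField V M} (hφ : φ.SmoothOn Set.univ) : twistedD η (twistedD η φ) = 0 := by
  funext x
  have hU := isOpen_univ (X := M)
  have hy := extChartAt_self_mem_chartPreimage (V := V) (Set.mem_univ x)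
  refine SpinorField.ext_inChart ?_
  rw [(hφ.twistedD hU hη).inChart_twistedD hU hy]
  have h0 : _root_.extDeriv (η.inChart x) (extChartAt 𝓘(ℝ, V) x x) = 0 := by
    rw [← hη.inChart_extDeriv hU hy, hdη]
    rfl
  refine Eq.trans ?_ ((spinorTwistedD_spinorTwistedD (hη.contDiffAt hU hy) h0
    (hφ.contDiffAt hU hy)).trans ?_)
  · refine spinorTwistedD_congr ?_
    filter_upwards [(isOpen_chartPreimage hU x).mem_nhds hy] with z hz
    rw [hφ.inChart_twistedD hU hz]
  · rfl

end Operators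

section Bracket

variable {V : Type*} [NormedAddCommGroup V] [NormedSpace ℝ V]
  {M : Type*} [TopologicalSpace M] [ChartedSpace V M]

/-- The section of `𝕋M` with given values in `V ⊕ V*`. -/
def GenField.ofModel (f : M → V × (V →L[ℝ] ℝ)) : GenField V M := f

/-- The inhomogeneous form with given values in `⋀ V*`. -/
def SpinorField.ofModel (f : M → Spinor V) : SpinorField V M := f

theorem SpinorField.inChart_add (φ ψ : SpinorField V M) (x₀ : M) (y : V) :
    (φ + ψ).inChart x₀ y = φ.inChart x₀ y + ψ.inChart x₀ y := rfl

theorem SpinorField.inChart_sub (φ ψ : SpinorField V M) (x₀ : M) (y : V) :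
    (φ - ψ).inChart x₀ y = φ.inChart x₀ y - ψ.inChart x₀ y := rfl

theorem genMap_add (B A : V →L[ℝ] V) (u w : V × (V →L[ℝ] ℝ)) :
    genMap B A (u + w) = genMap B A u + genMap B A w := by
  simp [genMap]

theorem genMap_smul (B A : V →L[ℝ] V) (c : ℝ) (u : V × (V →L[ℝ] ℝ)) :
    genMap B A (c • u) = c • genMap B A u := by
  simp [genMap]

theorem GenField.inChart_add (w w' : GenField V M) (x₀ : M) (y : V) :
    (w + w').inChart x₀ y = w.inChart x₀ y + w'.inChart x₀ y := genMap_add _ _ _ _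

theorem GenField.inChart_smul (c : ℝ) (w : GenField V M) (x₀ : M) (y : V) :
    (c • w).inChart x₀ y = c • w.inChart x₀ y := genMap_smul _ _ _ _

theorem GenField.inChart_fun_smul (f : M → ℝ) (w : GenField V M) (x₀ : M) (y : V) :
    GenField.inChart (fun x => f x • w x) x₀ y =
      f ((extChartAt 𝓘(ℝ, V) x₀).symm y) • w.inChart x₀ y := genMap_smul _ _ _ _

theorem exists_cutoff [FiniteDimensional ℝ V] [T2Space M] [IsManifold 𝓘(ℝ, V) ∞ M] {U : Set M}
    {x : M} (hU : U ∈ 𝓝 x) :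
    ∃ χ : M → ℝ, ContMDiff 𝓘(ℝ, V) 𝓘(ℝ, ℝ) ∞ χ ∧ (∀ᶠ z in 𝓝 x, χ z = 1) ∧ tsupport χ ⊆ U := by
  obtain ⟨f, -, hf⟩ := (SmoothBumpFunction.nhds_basis_tsupport (I := 𝓘(ℝ, V)) x).mem_iff.1 hU
  exact ⟨f, f.contMDiff, f.eventuallyEq_one, hf⟩

variable [IsManifold 𝓘(ℝ, V) ∞ M]

theorem FormField.SmoothOn.smul_of_tsupport {k : ℕ} {U : Set M} {a : FormField V M k}
    (ha : a.SmoothOn U) (hU : IsOpen U) {χ : M → ℝ} (hχ : ContMDiff 𝓘(ℝ, V) 𝓘(ℝ, ℝ) ∞ χ)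
    (hs : tsupport χ ⊆ U) : FormField.SmoothOn (fun x => χ x • a x) Set.univ :=
  (ContMDiffOn.smul_section_of_tsupport
    (V := fun x : M => TangentSpace 𝓘(ℝ, V) x [⋀^Fin k]→L[ℝ] Trivial M ℝ x) (s := a)
    hχ.contMDiffOn hU hs ha).contMDiffOn

theorem SpinorField.SmoothOn.smul_of_tsupport {U : Set M} {φ : SpinorField V M}
    (hφ : φ.SmoothOn U) (hU : IsOpen U) {χ : M → ℝ} (hχ : ContMDiff 𝓘(ℝ, V) 𝓘(ℝ, ℝ) ∞ χ)
    (hs : tsupport χ ⊆ U) : SpinorField.SmoothOn (fun x => χ x • φ x) Set.univ :=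
  fun k => FormField.SmoothOn.smul_of_tsupport (hφ k) hU hχ hs

theorem GenField.SmoothOn.smul_of_tsupport {U : Set M} {w : GenField V M}
    (hw : w.SmoothOn U) (hU : IsOpen U) {χ : M → ℝ} (hχ : ContMDiff 𝓘(ℝ, V) 𝓘(ℝ, ℝ) ∞ χ)
    (hs : tsupport χ ⊆ U) : GenField.SmoothOn (fun x => χ x • w x) Set.univ :=
  ⟨(ContMDiffOn.smul_section_of_tsupport
      (V := fun x : M => TangentSpace 𝓘(ℝ, V) x) (s := fun x => (w x).1)
      hχ.contMDiffOn hU hs hw.1).contMDiffOn,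
    (ContMDiffOn.smul_section_of_tsupport
      (V := fun x : M => TangentSpace 𝓘(ℝ, V) x →L[ℝ] Trivial M ℝ x) (s := fun x => (w x).2)
      hχ.contMDiffOn hU hs hw.2).contMDiffOn⟩

theorem GenField.SmoothOn.fun_smul {w : GenField V M} (hw : w.SmoothOn Set.univ) {f : M → ℝ}
    (hf : ContMDiff 𝓘(ℝ, V) 𝓘(ℝ, ℝ) ∞ f) : GenField.SmoothOn (fun x => f x • w x) Set.univ :=
  hw.smul_of_tsupport isOpen_univ hf (Set.subset_univ _)

theorem GenField.SmoothOn.add {w w' : GenField V M} {U : Set M} (hU : IsOpen U)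
    (hw : w.SmoothOn U) (hw' : w'.SmoothOn U) : (w + w').SmoothOn U :=
  GenField.smoothOn_of_inChart_self fun _ hx =>
    ((hw.contDiffAt hU (extChartAt_self_mem_chartPreimage hx)).add
      (hw'.contDiffAt hU (extChartAt_self_mem_chartPreimage hx))).congr_of_eventuallyEq
      (Filter.Eventually.of_forall fun _ => GenField.inChart_add _ _ _ _)

theorem GenField.SmoothOn.smul {w : GenField V M} {U : Set M} (hU : IsOpen U) (c : ℝ)
    (hw : w.SmoothOn U) : (c • w).SmoothOn U :=
  GenField.smoothOn_of_inChart_self fun _ hx =>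
    ((hw.contDiffAt hU (extChartAt_self_mem_chartPreimage hx)).const_smul c).congr_of_eventuallyEq
      (Filter.Eventually.of_forall fun _ => GenField.inChart_smul _ _ _ _)

theorem SpinorField.SmoothOn.add {φ ψ : SpinorField V M} {U : Set M} (hU : IsOpen U)
    (hφ : φ.SmoothOn U) (hψ : ψ.SmoothOn U) : (φ + ψ).SmoothOn U :=
  SpinorField.smoothOn_of_inChart_self fun _ hx k =>
    (hφ.contDiffAt hU (extChartAt_self_mem_chartPreimage hx) k).add
      (hψ.contDiffAt hU (extChartAt_self_mem_chartPreimage hx) k)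

theorem SpinorField.SmoothOn.smul {φ : SpinorField V M} {U : Set M} (hU : IsOpen U) (c : ℝ)
    (hφ : φ.SmoothOn U) : (c • φ).SmoothOn U :=
  SpinorField.smoothOn_of_inChart_self fun _ hx k =>
    (hφ.contDiffAt hU (extChartAt_self_mem_chartPreimage hx) k).const_smul c

theorem SpinorField.smoothOn_zero (U : Set M) : (0 : SpinorField V M).SmoothOn U :=
  SpinorField.smoothOn_of_inChart_self fun _ _ _ =>
    (contDiffAt_const (c := 0)).congr_of_eventuallyEq
      (Filter.Eventually.of_forall fun _ => ContinuousAlternatingMap.ext fun _ => rfl)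

/-- Every spinor at a point is the value of a global differential form. -/
theorem exists_smooth_inChart_eq [FiniteDimensional ℝ V] [T2Space M] {x₀ : M} {y : V}
    (hy : y ∈ (extChartAt 𝓘(ℝ, V) x₀).target) (s : Spinor V) :
    ∃ φ : SpinorField V M, φ.SmoothOn Set.univ ∧ φ.inChart x₀ y = s := by
  let ψ : SpinorField V M := SpinorField.ofModel fun x => s.pullback (chartDeriv x₀ x)
  have hψ : ∀ z ∈ (extChartAt 𝓘(ℝ, V) x₀).target, ψ.inChart x₀ z = s := fun z hz => by
    have h : ψ.inChart x₀ z = s.pullback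
      (chartDeriv x₀ ((extChartAt 𝓘(ℝ, V) x₀).symm z) ∘L chartSymmDeriv x₀ z) := rfl
    rw [h, chartDeriv_comp_chartSymmDeriv hz]
    rfl
  have hsm : ψ.SmoothOn (extChartAt 𝓘(ℝ, V) x₀).source := by
    refine SpinorField.smoothOn_of_inChart fun x hx => ⟨x₀, hx, fun k => ?_⟩
    refine (contDiffAt_const (c := s k)).congr_of_eventuallyEq ?_
    filter_upwards [(isOpen_extChartAt_target x₀).mem_nhds
      ((extChartAt 𝓘(ℝ, V) x₀).map_source hx)] with z hz
    rw [hψ z hz]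
  have hU := isOpen_extChartAt_source (I := 𝓘(ℝ, V)) x₀
  obtain ⟨χ, hχ, hχ1, hs⟩ := exists_cutoff (V := V)
    (hU.mem_nhds ((extChartAt 𝓘(ℝ, V) x₀).map_target hy))
  refine ⟨fun x => χ x • ψ x, hsm.smul_of_tsupport hU hχ hs, ?_⟩
  have h : SpinorField.inChart (fun x => χ x • ψ x) x₀ y =
    χ ((extChartAt 𝓘(ℝ, V) x₀).symm y) • ψ.inChart x₀ y := rfl
  rw [h, hχ1.self_of_nhds, hψ y hy, one_smul]

theorem SpinorField.SmoothOn.inChart_twistedD_rho {η : FormField V M 3} {w : GenField V M}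
    {φ : SpinorField V M} {U : Set M} (hU : IsOpen U) (hw : w.SmoothOn U) (hφ : φ.SmoothOn U)
    {x₀ : M} {y : V} (hy : y ∈ chartPreimage V U x₀) :
    (_root_.twistedD η (_root_.rho w φ)).inChart x₀ y = spinorTwistedD (η.inChart x₀)
      (fun z => cliffordAct (w.inChart x₀ z) (φ.inChart x₀ z)) y := by
  rw [(hφ.rho hU hw).inChart_twistedD hU hy]
  refine spinorTwistedD_congr ?_
  filter_upwards [(isOpen_chartPreimage hU x₀).mem_nhds hy] with z hz
  rw [inChart_rho w φ hz.1]

variable [FiniteDimensional ℝ V]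

theorem inChart_derivedBracket {η : FormField V M 3} {w₁ w₂ : GenField V M} {φ : SpinorField V M}
    {U : Set M} (hU : IsOpen U) (hw₁ : w₁.SmoothOn U) (hw₂ : w₂.SmoothOn U) (hφ : φ.SmoothOn U)
    {x₀ : M} {y : V} (hy : y ∈ chartPreimage V U x₀) :
    (evenCommutator (rho w₁) (oddCommutator (rho w₂) (twistedD η)) φ).inChart x₀ y =
      cliffordAct (dorfman (η.inChart x₀) (w₁.inChart x₀) (w₂.inChart x₀) y)
        (φ.inChart x₀ y) := by
  have hd {F : Type _} [NormedAddCommGroup F] [NormedSpace ℝ F] {f : V → F}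
    (hf : ContDiffAt ℝ ∞ f y) : DifferentiableAt ℝ f y := hf.differentiableAt (by simp)
  rw [← derivedBracket_eq_dorfman (hd (hw₁.contDiffAt hU hy)) (hd (hw₂.contDiffAt hU hy))
    fun k => hd (hφ.contDiffAt hU hy k)]
  have h3 : (twistedD η (rho w₂ (rho w₁ φ))).inChart x₀ y = spinorTwistedD (η.inChart x₀)
      (fun z => cliffordAct (w₂.inChart x₀ z)
        (cliffordAct (w₁.inChart x₀ z) (φ.inChart x₀ z))) y := by
    rw [(hφ.rho hU hw₁).inChart_twistedD_rho hU hw₂ hy]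
    refine spinorTwistedD_congr ?_
    filter_upwards [(isOpen_chartPreimage hU x₀).mem_nhds hy] with z hz
    rw [inChart_rho w₁ φ hz.1]
  simp only [evenCommutator, oddCommutator, SpinorField.inChart_sub, SpinorField.inChart_add,
    inChart_rho _ _ hy.1, h3, hφ.inChart_twistedD hU hy, hφ.inChart_twistedD_rho hU hw₁ hy,
    hφ.inChart_twistedD_rho hU hw₂ hy]

variable [T2Space M]

theorem isCourantBracket_iff {η : FormField V M 3} (hη : η.SmoothOn Set.univ)
    {w₁ w₂ : GenField V M} (hw₁ : w₁.SmoothOn Set.univ) (hw₂ : w₂.SmoothOn Set.univ)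
    {w : GenField V M} :
    IsCourantBracket η w₁ w₂ w ↔ ∀ x₀, ∀ y ∈ (extChartAt 𝓘(ℝ, V) x₀).target,
      w.inChart x₀ y = dorfman (η.inChart x₀) (w₁.inChart x₀) (w₂.inChart x₀) y := by
  have hU := isOpen_univ (X := M)
  constructor
  · intro h x₀ y hy
    refine eq_of_forall_cliffordAct_eq fun s => ?_
    obtain ⟨φ, hφ, rfl⟩ := exists_smooth_inChart_eq hy s
    rw [← inChart_derivedBracket hU hw₁ hw₂ hφ ⟨hy, trivial⟩, ← h.2 φ hφ, inChart_rho _ _ hy]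
  · intro h
    refine ⟨GenField.smoothOn_of_inChart_self fun x hx => ?_, fun φ hφ => ?_⟩
    · have hy := extChartAt_self_mem_chartPreimage (V := V) hx
      refine (contDiffAt_dorfman (hη.contDiffAt hU hy) (hw₁.contDiffAt hU hy)
        (hw₂.contDiffAt hU hy)).congr_of_eventuallyEq ?_
      filter_upwards [(isOpen_extChartAt_target x).mem_nhds (mem_extChartAt_target x)] with z hz
      exact h x z hz
    · funext x
      have hy := mem_extChartAt_target (I := 𝓘(ℝ, V)) x
      refine SpinorField.ext_inChart ?_
      rw [inChart_derivedBracket hU hw₁ hw₂ hφ ⟨hy, trivial⟩, inChart_rho _ _ hy, h x _ hy]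

theorem exists_isCourantBracket {η : FormField V M 3} (hη : η.SmoothOn Set.univ)
    {w₁ w₂ : GenField V M} (hw₁ : w₁.SmoothOn Set.univ) (hw₂ : w₂.SmoothOn Set.univ) :
    ∃ w, IsCourantBracket η w₁ w₂ w := by
  have hU := isOpen_univ (X := M)
  let w : GenField V M := GenField.ofModel fun x =>
    dorfman (η.inChart x) (w₁.inChart x) (w₂.inChart x) (extChartAt 𝓘(ℝ, V) x x)
  have hw (φ : SpinorField V M) (hφ : φ.SmoothOn Set.univ) :
      rho w φ = evenCommutator (rho w₁) (oddCommutator (rho w₂) (twistedD η)) φ := by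
    funext x
    have hy := mem_extChartAt_target (I := 𝓘(ℝ, V)) x
    refine SpinorField.ext_inChart ?_
    rw [inChart_derivedBracket hU hw₁ hw₂ hφ ⟨hy, trivial⟩, inChart_rho _ _ hy, w.inChart_self]
    rfl
  refine ⟨w, (isCourantBracket_iff hη hw₁ hw₂).2 fun x₀ y hy => ?_⟩
  refine eq_of_forall_cliffordAct_eq fun s => ?_
  obtain ⟨φ, hφ, rfl⟩ := exists_smooth_inChart_eq hy s
  rw [← inChart_derivedBracket hU hw₁ hw₂ hφ ⟨hy, trivial⟩, ← hw φ hφ, inChart_rho _ _ hy]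

theorem IsCourantBracket.unique {η : FormField V M 3} (hη : η.SmoothOn Set.univ)
    {w₁ w₂ w w' : GenField V M} (hw₁ : w₁.SmoothOn Set.univ) (hw₂ : w₂.SmoothOn Set.univ)
    (h : IsCourantBracket η w₁ w₂ w) (h' : IsCourantBracket η w₁ w₂ w') : w = w' := by
  rw [isCourantBracket_iff hη hw₁ hw₂] at h h'
  funext x
  refine GenField.ext_inChart ?_
  rw [h x _ (mem_extChartAt_target x), h' x _ (mem_extChartAt_target x)]

theorem isCourantBracket_courantBracket {η : FormField V M 3} (hη : η.SmoothOn Set.univ)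
    {w₁ w₂ : GenField V M} (hw₁ : w₁.SmoothOn Set.univ) (hw₂ : w₂.SmoothOn Set.univ) :
    IsCourantBracket η w₁ w₂ (courantBracket η w₁ w₂) :=
  Classical.epsilon_spec (exists_isCourantBracket hη hw₁ hw₂)

/-- Sections of `𝕋M` are determined by their action on global differential forms. -/
theorem eq_of_forall_rho_eq {w w' : GenField V M}
    (h : ∀ φ : SpinorField V M, φ.SmoothOn Set.univ → rho w φ = rho w' φ) : w = w' := by
  funext x
  have hy := mem_extChartAt_target (I := 𝓘(ℝ, V)) x
  refine GenField.ext_inChart (eq_of_forall_cliffordAct_eq fun s => ?_)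
  obtain ⟨φ, hφ, rfl⟩ := exists_smooth_inChart_eq hy s
  rw [← inChart_rho _ _ hy, ← inChart_rho _ _ hy, h φ hφ]

end Bracket

section DorfmanAlgebra

variable {V : Type*} [NormedAddCommGroup V] [NormedSpace ℝ V]
  {η : V → V [⋀^Fin 3]→L[ℝ] ℝ} {w w₁ w₂ w₃ : V → V × (V →L[ℝ] ℝ)} {y : V}

theorem toCovector_apply (a : V [⋀^Fin 1]→L[ℝ] ℝ) (v : V) : toCovector a v = a fun _ => v := by
  change a (Matrix.vecCons v _) = _
  congr 1
  funext i
  rw [Subsingleton.elim i 0]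
  rfl

theorem dorfman_fst (η : V → V [⋀^Fin 3]→L[ℝ] ℝ) (w₁ w₂ : V → V × (V →L[ℝ] ℝ)) (y : V) :
    (dorfman η w₁ w₂ y).1 = (fderiv ℝ w₂ y (w₁ y).1).1 - (fderiv ℝ w₁ y (w₂ y).1).1 :=
  add_zero _

theorem dorfman_snd_apply (η : V → V [⋀^Fin 3]→L[ℝ] ℝ) (w₁ w₂ : V → V × (V →L[ℝ] ℝ)) (y v : V) :
    (dorfman η w₁ w₂ y).2 v = (fderiv ℝ w₂ y (w₁ y).1).2 v - (fderiv ℝ w₁ y (w₂ y).1).2 v +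
      (((η y).curryLeft (w₂ y).1).curryLeft (w₁ y).1 (fun _ => v) -
        diracPairing (w₁ y) (fderiv ℝ w₂ y v)) := by
  rw [← toCovector_apply]
  rfl

theorem eq_of_fst_eq_of_snd_apply_eq {u u' : V × (V →L[ℝ] ℝ)} (h₁ : u.1 = u'.1)
    (h₂ : ∀ v, u.2 v = u'.2 v) : u = u' :=
  Prod.ext h₁ (ContinuousLinearMap.ext h₂)

theorem dorfman_add_left (hw₁ : DifferentiableAt ℝ w₁ y) (hw₂ : DifferentiableAt ℝ w₂ y) :
    dorfman η (w₁ + w₂) w₃ y = dorfman η w₁ w₃ y + dorfman η w₂ w₃ y := by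
  refine eq_of_fst_eq_of_snd_apply_eq ?_ fun v => ?_
  · simp only [dorfman_fst, fderiv_add hw₁ hw₂, Pi.add_apply, Prod.fst_add, map_add,
      _root_.add_apply]
    abel
  · simp only [dorfman_snd_apply, fderiv_add hw₁ hw₂, Pi.add_apply, Prod.fst_add, Prod.snd_add,
      map_add, _root_.add_apply, diracPairing, ContinuousAlternatingMap.add_apply]
    ring

theorem dorfman_add_right (hw₂ : DifferentiableAt ℝ w₂ y) (hw₃ : DifferentiableAt ℝ w₃ y) :
    dorfman η w₁ (w₂ + w₃) y = dorfman η w₁ w₂ y + dorfman η w₁ w₃ y := by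
  refine eq_of_fst_eq_of_snd_apply_eq ?_ fun v => ?_
  · simp only [dorfman_fst, fderiv_add hw₂ hw₃, Pi.add_apply, Prod.fst_add, map_add,
      _root_.add_apply]
    abel
  · simp only [dorfman_snd_apply, fderiv_add hw₂ hw₃, Pi.add_apply, Prod.fst_add, Prod.snd_add,
      map_add, _root_.add_apply, diracPairing, ContinuousAlternatingMap.curryLeft_add,
      ContinuousAlternatingMap.add_apply]
    ring

theorem dorfman_smul_left (c : ℝ) (hw₁ : DifferentiableAt ℝ w₁ y) :
    dorfman η (c • w₁) w₂ y = c • dorfman η w₁ w₂ y := by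
  refine eq_of_fst_eq_of_snd_apply_eq ?_ fun v => ?_
  · simp only [dorfman_fst, fderiv_const_smul hw₁, Pi.smul_apply, Prod.smul_fst, map_smul,
      _root_.smul_apply, smul_sub]
  · simp only [dorfman_snd_apply, fderiv_const_smul hw₁, Pi.smul_apply, Prod.smul_fst,
      Prod.smul_snd, map_smul, _root_.smul_apply, diracPairing, smul_eq_mul,
      ContinuousAlternatingMap.smul_apply]
    ring

theorem dorfman_fun_smul_right {f : V → ℝ} (hf : DifferentiableAt ℝ f y)
    (hw₂ : DifferentiableAt ℝ w₂ y) (h : diracPairing (w₁ y) (w₂ y) = 0) :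
    dorfman η w₁ (fun z => f z • w₂ z) y =
      f y • dorfman η w₁ w₂ y + fderiv ℝ f y (w₁ y).1 • w₂ y := by
  have hd (v : V) : fderiv ℝ (fun z => f z • w₂ z) y v =
      f y • fderiv ℝ w₂ y v + fderiv ℝ f y v • w₂ y :=
    congrArg (fun L => L v) (fderiv_fun_smul hf hw₂)
  refine eq_of_fst_eq_of_snd_apply_eq ?_ fun v => ?_
  · simp only [dorfman_fst, hd, Prod.smul_fst, Prod.fst_add, map_smul, smul_sub]
    abel
  · rw [diracPairing] at h
    simp only [dorfman_snd_apply, hd, Prod.smul_fst, Prod.smul_snd, Prod.fst_add, Prod.snd_add,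
      map_smul, map_add, _root_.add_apply, _root_.smul_apply, diracPairing, smul_eq_mul,
      ContinuousAlternatingMap.curryLeft_smul, ContinuousAlternatingMap.smul_apply]
    linear_combination (-fderiv ℝ f y v) * h

theorem dorfman_self (hw : DifferentiableAt ℝ w y)
    (h : ∀ᶠ z in 𝓝 y, diracPairing (w z) (w z) = 0) : dorfman η w w y = 0 := by
  refine eq_of_fst_eq_of_snd_apply_eq ?_ fun v => ?_
  · rw [dorfman_fst, sub_self, Prod.fst_zero]
  · have h1 : ((η y).curryLeft (w y).1).curryLeft (w y).1 (fun _ => v) = 0 :=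
      (η y).map_eq_zero_of_eq _ (i := 0) (j := 1) rfl (by decide)
    have h3 := (diracPairingCLM V).fderiv_apply₂ hw hw v
    have h4 : (fun z => diracPairingCLM V (w z) (w z)) =ᶠ[𝓝 y] fun _ => 0 := h
    rw [h4.fderiv_eq, diracPairingCLM_apply, diracPairing_comm, diracPairingCLM_apply] at h3
    simp only [fderiv_fun_const, Pi.zero_apply, _root_.zero_apply] at h3
    rw [dorfman_snd_apply, h1]
    simp only [Prod.snd_zero, _root_.zero_apply]
    linarith

end DorfmanAlgebra

section Anchor

variable {V : Type*} [NormedAddCommGroup V] [NormedSpace ℝ V]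
  {M : Type*} [TopologicalSpace M] [ChartedSpace V M] [IsManifold 𝓘(ℝ, V) ∞ M]

theorem mpullbackWithin_extChartAt_symm (w : GenField V M) {x₀ : M} {y : V}
    (hy : y ∈ (extChartAt 𝓘(ℝ, V) x₀).target) :
    VectorField.mpullbackWithin 𝓘(ℝ, V) 𝓘(ℝ, V) (extChartAt 𝓘(ℝ, V) x₀).symm
      (fun x => (w x).1) (Set.range 𝓘(ℝ, V)) y = (w.inChart x₀ y).1 := by
  rw [VectorField.mpullbackWithin_apply, modelWithCornersSelf_coe, Set.range_id, mfderivWithin_univ]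
  have h : (chartSymmDeriv x₀ y).inverse =
      chartDeriv (V := V) x₀ ((extChartAt 𝓘(ℝ, V) x₀).symm y) :=
    ContinuousLinearMap.inverse_eq (chartSymmDeriv_comp_chartDeriv hy)
      (chartDeriv_comp_chartSymmDeriv hy)
  exact congrArg (fun L : V →L[ℝ] V => L (w.toModel ((extChartAt 𝓘(ℝ, V) x₀).symm y)).1) h

theorem mlieBracket_eq_lieBracket_inChart (w₁ w₂ : GenField V M) (x : M) :
    VectorField.mlieBracket 𝓘(ℝ, V) (fun y => (w₁ y).1) (fun y => (w₂ y).1) x =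
      VectorField.lieBracket ℝ (fun z => (w₁.inChart x z).1) (fun z => (w₂.inChart x z).1)
        (extChartAt 𝓘(ℝ, V) x x) := by
  have h (w : GenField V M) : VectorField.mpullbackWithin 𝓘(ℝ, V) 𝓘(ℝ, V)
      (extChartAt 𝓘(ℝ, V) x).symm (fun x => (w x).1) (Set.range 𝓘(ℝ, V))
      =ᶠ[𝓝 (extChartAt 𝓘(ℝ, V) x x)] fun z => (w.inChart x z).1 := by
    filter_upwards [(isOpen_extChartAt_target x).mem_nhds (mem_extChartAt_target x)] with z hz
    exact mpullbackWithin_extChartAt_symm w hz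
  have hs : (extChartAt 𝓘(ℝ, V) x).symm ⁻¹' Set.univ ∩ Set.range 𝓘(ℝ, V) = Set.univ := by
    simp
  have hL (X Y : V → V) (y : V) : VectorField.lieBracketWithin ℝ X Y
      ((extChartAt 𝓘(ℝ, V) x).symm ⁻¹' Set.univ ∩ Set.range 𝓘(ℝ, V)) y =
      VectorField.lieBracket ℝ X Y y := by
    rw [hs, VectorField.lieBracketWithin_univ]
  rw [← VectorField.mlieBracketWithin_univ, VectorField.mlieBracketWithin_apply,
    mfderiv_extChartAt_self]
  refine (congrFun (congrArg DFunLike.coe ContinuousLinearMap.inverse_id) _).trans ?_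
  exact (hL _ _ _).trans ((h w₁).lieBracket_vectorField_eq (h w₂))

end Anchor

/-- The derived bracket `[R, [S, D]]` of odd elements `R`, `S`. -/
def derivedBracket {A : Type*} [Ring A] (D R S : A) : A :=
  R * (S * D + D * S) - (S * D + D * S) * R

theorem derivedBracket_jacobi {A : Type*} [Ring A] {D : A} (hD : D * D = 0) (R₁ R₂ R₃ : A) :
    derivedBracket D R₁ (derivedBracket D R₂ R₃) + derivedBracket D (derivedBracket D R₁ R₃) R₂ -
      derivedBracket D (derivedBracket D R₁ R₂) R₃ = 0 := by
  obtain ⟨B, hB⟩ : ∃ B : A → A, ∀ S, S * D + D * S = B S := ⟨_, fun _ => rfl⟩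
  have h (R : A) : D * B R = B R * D := by
    rw [← hB, mul_add, add_mul, ← mul_assoc D D, hD, mul_assoc R D, hD, zero_mul, mul_zero,
      zero_add, add_zero, mul_assoc]
  have h2 : B (R₂ * B R₃ - B R₃ * R₂) = B R₂ * B R₃ - B R₃ * B R₂ := by
    have h3 : B (R₂ * B R₃ - B R₃ * R₂) =
        R₂ * (B R₃ * D) - B R₃ * R₂ * D + (D * R₂ * B R₃ - (D * B R₃) * R₂) := by
      rw [← hB]
      noncomm_ring
    have h4 : (R₂ * D + D * R₂) * B R₃ = R₂ * (D * B R₃) + D * R₂ * B R₃ := by noncomm_ring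
    rw [h3, ← hB R₂, h4, h]
    noncomm_ring
  simp only [derivedBracket, hB, h2]
  noncomm_ring

theorem derivedBracket_neg_left {A : Type*} [Ring A] (D R S : A) :
    derivedBracket D (-R) S = -derivedBracket D R S := by
  simp only [derivedBracket]
  noncomm_ring

theorem derivedBracket_cyclic_sum_eq_zero {A : Type*} [Ring A] {D R₁ R₂ R₃ : A} (hD : D * D = 0)
    {R₁₂ R₂₃ R₁₃ R₃₁ L₁ L₂ L₃ L₂' L₃' : A} (h₁₂ : R₁₂ = derivedBracket D R₁ R₂)
    (h₂₃ : R₂₃ = derivedBracket D R₂ R₃) (h₁₃ : R₁₃ = derivedBracket D R₁ R₃)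
    (h₃₁ : R₃₁ + R₁₃ = 0) (hL₁ : L₁ = derivedBracket D R₁ R₂₃)
    (hL₂' : L₂' = derivedBracket D R₃₁ R₂) (hL₂ : L₂ + L₂' = 0)
    (hL₃' : L₃' = derivedBracket D R₁₂ R₃) (hL₃ : L₃ + L₃' = 0) : L₁ + L₂ + L₃ = 0 := by
  rw [eq_neg_of_add_eq_zero_left hL₂, eq_neg_of_add_eq_zero_left hL₃, hL₁, hL₂', hL₃',
    eq_neg_of_add_eq_zero_left h₃₁, h₁₂, h₂₃, h₁₃, derivedBracket_neg_left, neg_neg,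
    ← sub_eq_add_neg, derivedBracket_jacobi hD]

section LieAlgebroid

variable {V : Type*} [NormedAddCommGroup V] [NormedSpace ℝ V]
  {M : Type*} [TopologicalSpace M] [ChartedSpace V M]

theorem rho_add (w : GenField V M) (φ ψ : SpinorField V M) :
    rho w (φ + ψ) = rho w φ + rho w ψ :=
  funext fun x => map_add (cliffordEnd (w.toModel x)) (φ.toModel x) (ψ.toModel x)

theorem rho_add_left (w w' : GenField V M) (φ : SpinorField V M) :
    rho (w + w') φ = rho w φ + rho w' φ :=
  funext fun x => congr($(map_add cliffordEnd (w.toModel x) (w'.toModel x)) (φ.toModel x))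

theorem rho_zero_left (φ : SpinorField V M) : rho 0 φ = 0 :=
  funext fun x => congr($(map_zero (cliffordEnd (V := V))) (φ.toModel x))

variable [IsManifold 𝓘(ℝ, V) ∞ M]

theorem diracPairing_inChart (w w' : GenField V M) {x₀ : M} {y : V}
    (hy : y ∈ (extChartAt 𝓘(ℝ, V) x₀).target) :
    diracPairing (w.inChart x₀ y) (w'.inChart x₀ y) =
      diracPairing (w.toModel ((extChartAt 𝓘(ℝ, V) x₀).symm y))
        (w'.toModel ((extChartAt 𝓘(ℝ, V) x₀).symm y)) := by
  simp only [diracPairing, GenField.inChart, genMap, ContinuousLinearMap.comp_apply]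
  rw [← ContinuousLinearMap.comp_apply (chartSymmDeriv x₀ y),
    ← ContinuousLinearMap.comp_apply (chartSymmDeriv x₀ y), chartSymmDeriv_comp_chartDeriv hy]
  rfl

theorem diracPairing_inChart_of_mem {E : (x : M) → Submodule ℝ (GenTangent V x)}
    (hE : ∀ x, IsLagrangian (E x)) {w w' : GenField V M} (hw : w ∈ sectionsOn E Set.univ)
    (hw' : w' ∈ sectionsOn E Set.univ) {x₀ : M} {y : V}
    (hy : y ∈ (extChartAt 𝓘(ℝ, V) x₀).target) :
    diracPairing (w.inChart x₀ y) (w'.inChart x₀ y) = 0 := by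
  rw [diracPairing_inChart w w' hy]
  exact ((hE _) _).1 (hw.2 _ trivial) _ (hw'.2 _ trivial)

theorem sectionsOn_add {E : (x : M) → Submodule ℝ (GenTangent V x)} {w w' : GenField V M}
    (hw : w ∈ sectionsOn E Set.univ) (hw' : w' ∈ sectionsOn E Set.univ) :
    w + w' ∈ sectionsOn E Set.univ :=
  ⟨hw.1.add isOpen_univ hw'.1, fun x hx => (E x).add_mem (hw.2 x hx) (hw'.2 x hx)⟩

theorem GenField.SmoothOn.differentiableAt_inChart {w : GenField V M} (hw : w.SmoothOn Set.univ)
    (x : M) : DifferentiableAt ℝ (w.inChart x) (extChartAt 𝓘(ℝ, V) x x) :=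
  (hw.contDiffAt isOpen_univ
    (extChartAt_self_mem_chartPreimage (Set.mem_univ x))).differentiableAt (by simp)

variable (V M) in
/-- The group of differential forms on `M`. -/
def smoothForms : AddSubgroup (SpinorField V M) where
  carrier := {φ | φ.SmoothOn Set.univ}
  add_mem' hφ hψ := hφ.add isOpen_univ hψ
  zero_mem' := SpinorField.smoothOn_zero _
  neg_mem' {φ} hφ := neg_one_smul ℝ φ ▸ SpinorField.SmoothOn.smul isOpen_univ (-1) hφ

/-- The operator `ρ(w)` on `Ω(M)`. -/
noncomputable def rhoHom (w : GenField V M) (hw : w.SmoothOn Set.univ) :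
    AddMonoid.End (smoothForms V M) :=
  AddMonoidHom.mk' (fun φ => ⟨rho w φ, φ.2.rho isOpen_univ hw⟩)
    fun φ ψ => Subtype.ext (rho_add w φ.1 ψ.1)

theorem rhoHom_add {w w' : GenField V M} (hw : w.SmoothOn Set.univ)
    (hw' : w'.SmoothOn Set.univ) :
    rhoHom (w + w') (hw.add isOpen_univ hw') = rhoHom w hw + rhoHom w' hw' :=
  AddMonoidHom.ext fun φ => Subtype.ext (rho_add_left w w' φ.1)

theorem rhoHom_eq_zero {w : GenField V M} (hw : w.SmoothOn Set.univ) (h : w = 0) :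
    rhoHom w hw = 0 :=
  AddMonoidHom.ext fun φ => Subtype.ext (h ▸ rho_zero_left φ.1)

variable [FiniteDimensional ℝ V]

theorem spinorTwistedD_add {η : V → V [⋀^Fin 3]→L[ℝ] ℝ} {Φ Ψ : V → Spinor V} {y : V}
    (hΦ : ∀ k, DifferentiableAt ℝ (fun z => Φ z k) y)
    (hΨ : ∀ k, DifferentiableAt ℝ (fun z => Ψ z k) y) :
    spinorTwistedD η (fun z => Φ z + Ψ z) y = spinorTwistedD η Φ y + spinorTwistedD η Ψ y := by
  rw [spinorTwistedD, spinorTwistedD, spinorTwistedD, spinorExtDeriv_add hΦ hΨ,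
    add_add_add_comm, threeFormWedge_eq_formEnd, threeFormWedge_eq_formEnd,
    threeFormWedge_eq_formEnd, map_add]

theorem SpinorField.SmoothOn.twistedD_add {η : FormField V M 3} {φ ψ : SpinorField V M}
    (hφ : φ.SmoothOn Set.univ) (hψ : ψ.SmoothOn Set.univ) :
    _root_.twistedD η (φ + ψ) = _root_.twistedD η φ + _root_.twistedD η ψ := by
  funext x
  have hU := isOpen_univ (X := M)
  have hy := extChartAt_self_mem_chartPreimage (V := V) (Set.mem_univ x)
  refine SpinorField.ext_inChart ?_
  have h : (φ + ψ).inChart x = fun z => φ.inChart x z + ψ.inChart x z := rfl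
  have h' := spinorTwistedD_add (η := η.inChart x)
    (fun k => (hφ.contDiffAt hU hy k).differentiableAt (by simp))
    (fun k => (hψ.contDiffAt hU hy k).differentiableAt (by simp))
  rw [← h, ← hφ.inChart_twistedD hU hy, ← hψ.inChart_twistedD hU hy] at h'
  exact ((hφ.add hU hψ).inChart_twistedD hU hy).trans h'

/-- The operator `d + η` on `Ω(M)`. -/
noncomputable def twistedDHom (η : FormField V M 3) (hη : η.SmoothOn Set.univ) :
    AddMonoid.End (smoothForms V M) :=
  AddMonoidHom.mk' (fun φ => ⟨twistedD η φ, φ.2.twistedD isOpen_univ hη⟩)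
    fun φ ψ => Subtype.ext (φ.2.twistedD_add ψ.2)

theorem twistedDHom_mul_self {η : FormField V M 3} (hη : η.SmoothOn Set.univ)
    (hdη : η.extDeriv = 0) : twistedDHom η hη * twistedDHom η hη = 0 :=
  AddMonoidHom.ext fun φ => Subtype.ext (twistedD_twistedD hη hdη φ.2)

theorem IsCourantBracket.rhoHom_eq {η : FormField V M 3} (hη : η.SmoothOn Set.univ)
    {w₁ w₂ w : GenField V M} (hw₁ : w₁.SmoothOn Set.univ) (hw₂ : w₂.SmoothOn Set.univ)
    (h : IsCourantBracket η w₁ w₂ w) : rhoHom w h.1 =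
      derivedBracket (twistedDHom η hη) (rhoHom w₁ hw₁) (rhoHom w₂ hw₂) :=
  AddMonoidHom.ext fun φ => Subtype.ext (h.2 φ φ.2)

variable [T2Space M]

theorem eq_zero_of_rhoHom_eq_zero {w : GenField V M} (hw : w.SmoothOn Set.univ)
    (h : rhoHom w hw = 0) : w = 0 := by
  refine eq_of_forall_rho_eq fun φ hφ => ?_
  have h1 : rho w φ = (rhoHom w hw ⟨φ, hφ⟩ : SpinorField V M) := rfl
  rw [h1, h, rho_zero_left]
  rfl

section CourantAlgebra

variable {η : FormField V M 3} {w w₁ w₂ w₃ : GenField V M}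

theorem inChart_courantBracket (hη : η.SmoothOn Set.univ) (hw₁ : w₁.SmoothOn Set.univ)
    (hw₂ : w₂.SmoothOn Set.univ) {x₀ : M} {y : V} (hy : y ∈ (extChartAt 𝓘(ℝ, V) x₀).target) :
    (courantBracket η w₁ w₂).inChart x₀ y =
      dorfman (η.inChart x₀) (w₁.inChart x₀) (w₂.inChart x₀) y :=
  (isCourantBracket_iff hη hw₁ hw₂).1 (isCourantBracket_courantBracket hη hw₁ hw₂) x₀ y hy

theorem courantBracket_smoothOn (hη : η.SmoothOn Set.univ) (hw₁ : w₁.SmoothOn Set.univ)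
    (hw₂ : w₂.SmoothOn Set.univ) : (courantBracket η w₁ w₂).SmoothOn Set.univ :=
  (isCourantBracket_courantBracket hη hw₁ hw₂).1

theorem courantBracket_add_left (hη : η.SmoothOn Set.univ) (hw₁ : w₁.SmoothOn Set.univ)
    (hw₂ : w₂.SmoothOn Set.univ) (hw₃ : w₃.SmoothOn Set.univ) :
    courantBracket η (w₁ + w₂) w₃ = courantBracket η w₁ w₃ + courantBracket η w₂ w₃ := by
  funext x
  have hy := mem_extChartAt_target (I := 𝓘(ℝ, V)) x
  refine GenField.ext_inChart ?_
  rw [GenField.inChart_add, inChart_courantBracket hη (hw₁.add isOpen_univ hw₂) hw₃ hy,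
    inChart_courantBracket hη hw₁ hw₃ hy, inChart_courantBracket hη hw₂ hw₃ hy,
    ← dorfman_add_left (hw₁.differentiableAt_inChart x) (hw₂.differentiableAt_inChart x),
    funext (GenField.inChart_add w₁ w₂ x)]
  rfl

theorem courantBracket_add_right (hη : η.SmoothOn Set.univ) (hw₁ : w₁.SmoothOn Set.univ)
    (hw₂ : w₂.SmoothOn Set.univ) (hw₃ : w₃.SmoothOn Set.univ) :
    courantBracket η w₁ (w₂ + w₃) = courantBracket η w₁ w₂ + courantBracket η w₁ w₃ := by
  funext x
  have hy := mem_extChartAt_target (I := 𝓘(ℝ, V)) x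
  refine GenField.ext_inChart ?_
  rw [GenField.inChart_add, inChart_courantBracket hη hw₁ (hw₂.add isOpen_univ hw₃) hy,
    inChart_courantBracket hη hw₁ hw₂ hy, inChart_courantBracket hη hw₁ hw₃ hy,
    ← dorfman_add_right (hw₂.differentiableAt_inChart x) (hw₃.differentiableAt_inChart x),
    funext (GenField.inChart_add w₂ w₃ x)]
  rfl

theorem courantBracket_smul_left (hη : η.SmoothOn Set.univ) (c : ℝ) (hw₁ : w₁.SmoothOn Set.univ)
    (hw₂ : w₂.SmoothOn Set.univ) :
    courantBracket η (c • w₁) w₂ = c • courantBracket η w₁ w₂ := by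
  funext x
  have hy := mem_extChartAt_target (I := 𝓘(ℝ, V)) x
  refine GenField.ext_inChart ?_
  rw [GenField.inChart_smul, inChart_courantBracket hη (hw₁.smul isOpen_univ c) hw₂ hy,
    inChart_courantBracket hη hw₁ hw₂ hy,
    ← dorfman_smul_left c (hw₁.differentiableAt_inChart x),
    funext (GenField.inChart_smul c w₁ x)]
  rfl

variable {E : (x : M) → Submodule ℝ (GenTangent V x)}

theorem courantBracket_fun_smul_right (hη : η.SmoothOn Set.univ) (hE : ∀ x, IsLagrangian (E x))
    {f : M → ℝ} (hf : ContMDiff 𝓘(ℝ, V) 𝓘(ℝ, ℝ) ∞ f) (hw₁ : w₁ ∈ sectionsOn E Set.univ)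
    (hw₂ : w₂ ∈ sectionsOn E Set.univ) (x : M) :
    courantBracket η w₁ (fun y => f y • w₂ y) x = f x • courantBracket η w₁ w₂ x +
      (show ℝ from mfderiv 𝓘(ℝ, V) 𝓘(ℝ, ℝ) f x (w₁ x).1) • w₂ x := by
  have hy := mem_extChartAt_target (I := 𝓘(ℝ, V)) x
  have hf' : DifferentiableAt ℝ (fun z => f ((extChartAt 𝓘(ℝ, V) x).symm z))
      (extChartAt 𝓘(ℝ, V) x x) :=
    (contMDiffAt_iff_contDiffAt_comp_symm.1 (hf x)).differentiableAt (by simp)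
  have h := inChart_courantBracket hη hw₁.1 (hw₂.1.fun_smul hf) hy
  rw [funext (GenField.inChart_fun_smul f w₂ x), dorfman_fun_smul_right hf'
    (hw₂.1.differentiableAt_inChart x) (diracPairing_inChart_of_mem hE hw₁ hw₂ hy),
    ← inChart_courantBracket hη hw₁.1 hw₂.1 hy, extChartAt_to_inv] at h
  simp only [GenField.inChart_self] at h
  have hm : mfderiv 𝓘(ℝ, V) 𝓘(ℝ, ℝ) f x = fderiv ℝ
      (fun z => f ((extChartAt 𝓘(ℝ, V) x).symm z)) (extChartAt 𝓘(ℝ, V) x x) := by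
    rw [((hf x).mdifferentiableAt (by simp)).mfderiv, modelWithCornersSelf_coe, Set.range_id,
      fderivWithin_univ]
    rfl
  rw [hm]
  exact h

theorem courantBracket_smul_right (hη : η.SmoothOn Set.univ) (hE : ∀ x, IsLagrangian (E x))
    (c : ℝ) (hw₁ : w₁ ∈ sectionsOn E Set.univ) (hw₂ : w₂ ∈ sectionsOn E Set.univ) :
    courantBracket η w₁ (c • w₂) = c • courantBracket η w₁ w₂ := by
  funext x
  refine (courantBracket_fun_smul_right hη hE (f := fun _ => c) contMDiff_const hw₁ hw₂ x).trans ?_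
  rw [mfderiv_const]
  exact (congrArg (c • courantBracket η w₁ w₂ x + ·) (zero_smul ℝ (w₂ x))).trans (add_zero _)

theorem courantBracket_self (hη : η.SmoothOn Set.univ) (hE : ∀ x, IsLagrangian (E x))
    (hw : w ∈ sectionsOn E Set.univ) : courantBracket η w w = 0 := by
  funext x
  have hy := mem_extChartAt_target (I := 𝓘(ℝ, V)) x
  have h := inChart_courantBracket hη hw.1 hw.1 hy
  rw [dorfman_self (hw.1.differentiableAt_inChart x), GenField.inChart_self] at h
  · exact h
  · filter_upwards [(isOpen_extChartAt_target x).mem_nhds hy] with z hz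
    exact diracPairing_inChart_of_mem hE hw hw hz

theorem courantBracket_add_swap (hη : η.SmoothOn Set.univ) (hE : ∀ x, IsLagrangian (E x))
    (hw₁ : w₁ ∈ sectionsOn E Set.univ) (hw₂ : w₂ ∈ sectionsOn E Set.univ) :
    courantBracket η w₁ w₂ + courantBracket η w₂ w₁ = 0 := by
  have h := courantBracket_self hη hE (sectionsOn_add hw₁ hw₂)
  rwa [courantBracket_add_left hη hw₁.1 hw₂.1 (hw₁.1.add isOpen_univ hw₂.1),
    courantBracket_add_right hη hw₁.1 hw₁.1 hw₂.1, courantBracket_add_right hη hw₂.1 hw₁.1 hw₂.1,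
    courantBracket_self hη hE hw₁, courantBracket_self hη hE hw₂, zero_add, add_zero] at h

theorem courantBracket_fst (hη : η.SmoothOn Set.univ) (hw₁ : w₁.SmoothOn Set.univ)
    (hw₂ : w₂.SmoothOn Set.univ) (x : M) : (courantBracket η w₁ w₂ x).1 =
      VectorField.mlieBracket 𝓘(ℝ, V) (fun y => (w₁ y).1) (fun y => (w₂ y).1) x := by
  have hy := mem_extChartAt_target (I := 𝓘(ℝ, V)) x
  have h := congrArg Prod.fst (inChart_courantBracket hη hw₁ hw₂ hy)
  rw [GenField.inChart_self, dorfman_fst] at h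
  refine (Eq.trans h ?_).trans (mlieBracket_eq_lieBracket_inChart w₁ w₂ x).symm
  rw [VectorField.lieBracket, (hw₁.differentiableAt_inChart x).hasFDerivAt.fst.fderiv,
    (hw₂.differentiableAt_inChart x).hasFDerivAt.fst.fderiv]
  rfl

theorem courantBracket_jacobi (hη : η.SmoothOn Set.univ) (hdη : η.extDeriv = 0)
    (hE : ∀ x, IsLagrangian (E x))
    (hcl : ∀ u ∈ sectionsOn E Set.univ, ∀ u' ∈ sectionsOn E Set.univ,
      courantBracket η u u' ∈ sectionsOn E Set.univ)
    (hw₁ : w₁ ∈ sectionsOn E Set.univ) (hw₂ : w₂ ∈ sectionsOn E Set.univ)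
    (hw₃ : w₃ ∈ sectionsOn E Set.univ) :
    courantBracket η w₁ (courantBracket η w₂ w₃) + courantBracket η w₂ (courantBracket η w₃ w₁) +
      courantBracket η w₃ (courantBracket η w₁ w₂) = 0 := by
  have hc {u u' : GenField V M} (hu : u ∈ sectionsOn E Set.univ)
      (hu' : u' ∈ sectionsOn E Set.univ) :=
    (isCourantBracket_courantBracket hη hu.1 hu'.1).rhoHom_eq hη hu.1 hu'.1
  have hs {u u' : GenField V M} (hu : u ∈ sectionsOn E Set.univ)
      (hu' : u' ∈ sectionsOn E Set.univ) :
      rhoHom _ (hcl u hu u' hu').1 + rhoHom _ (hcl u' hu' u hu).1 = 0 :=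
    (rhoHom_add _ _).symm.trans (rhoHom_eq_zero _ (courantBracket_add_swap hη hE hu hu'))
  have h12 := hcl _ hw₁ _ hw₂
  have h23 := hcl _ hw₂ _ hw₃
  have h31 := hcl _ hw₃ _ hw₁
  refine eq_zero_of_rhoHom_eq_zero (((hcl _ hw₁ _ h23).1.add isOpen_univ
    (hcl _ hw₂ _ h31).1).add isOpen_univ (hcl _ hw₃ _ h12).1) ?_
  refine (rhoHom_add ((hcl _ hw₁ _ h23).1.add isOpen_univ (hcl _ hw₂ _ h31).1)
    (hcl _ hw₃ _ h12).1).trans ?_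
  rw [rhoHom_add (hcl _ hw₁ _ h23).1 (hcl _ hw₂ _ h31).1]
  exact derivedBracket_cyclic_sum_eq_zero (twistedDHom_mul_self hη hdη)
    (hc hw₁ hw₂) (hc hw₂ hw₃) (hc hw₁ hw₃) (hs hw₃ hw₁) (hc hw₁ h23) (hc h31 hw₂) (hs hw₂ h31)
    (hc h12 hw₃) (hs hw₃ h12)

theorem isLieAlgebroid_courantBracket (hη : η.SmoothOn Set.univ) (hdη : η.extDeriv = 0)
    (hE : ∀ x, IsLagrangian (E x))
    (hcl : ∀ u ∈ sectionsOn E Set.univ, ∀ u' ∈ sectionsOn E Set.univ,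
      courantBracket η u u' ∈ sectionsOn E Set.univ) :
    IsLieAlgebroid E (courantBracket η) where
  closed := hcl
  add_left _ h₁ _ h₂ _ h₃ := courantBracket_add_left hη h₁.1 h₂.1 h₃.1
  smul_left c _ h₁ _ h₂ := courantBracket_smul_left hη c h₁.1 h₂.1
  add_right _ h₁ _ h₂ _ h₃ := courantBracket_add_right hη h₁.1 h₂.1 h₃.1
  smul_right c _ h₁ _ h₂ := courantBracket_smul_right hη hE c h₁ h₂
  self _ h := courantBracket_self hη hE h
  jacobi _ h₁ _ h₂ _ h₃ := courantBracket_jacobi hη hdη hE hcl h₁ h₂ h₃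
  anchor _ h₁ _ h₂ x := courantBracket_fst hη h₁.1 h₂.1 x
  leibniz _ hf _ h₁ _ h₂ x := courantBracket_fun_smul_right hη hE hf h₁ h₂ x

end CourantAlgebra

end LieAlgebroid

theorem cliffordAct_foldr_eq_zero_of_mem {V : Type*} [NormedAddCommGroup V] [NormedSpace ℝ V]
    {u : V × (V →L[ℝ] ℝ)} {l : List (V × (V →L[ℝ] ℝ))} (hu : u ∈ l)
    (h : ∀ w ∈ l, diracPairing u w = 0) (φ : Spinor V) :
    cliffordAct u (l.foldr cliffordAct φ) = 0 := by
  induction l with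
  | nil => simp at hu
  | cons w l ih =>
    rw [List.foldr_cons]
    have h1 := cliffordAct_cliffordAct_add u w (l.foldr cliffordAct φ)
    rw [h w List.mem_cons_self, zero_smul] at h1
    rcases List.mem_cons.1 hu with rfl | hu'
    · rw [← two_smul ℝ] at h1
      exact (smul_eq_zero.1 h1).resolve_left two_ne_zero
    · rw [ih hu' fun w' hw' => h w' (List.mem_cons_of_mem _ hw'), 
        ← cliffordEnd_apply w 0, map_zero, add_zero] at h1
      exact h1

section Integrability

variable {V : Type*} [NormedAddCommGroup V] [NormedSpace ℝ V]
  {M : Type*} [TopologicalSpace M] [ChartedSpace V M]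

theorem rho_zero (w : GenField V M) : rho w (0 : SpinorField V M) = 0 :=
  funext fun x => map_zero (cliffordEnd (w.toModel x))

theorem rho_congr_apply {w w' : GenField V M} {φ ψ : SpinorField V M} {x : M} (hw : w x = w' x)
    (hφ : φ x = ψ x) : rho w φ x = rho w' ψ x := by
  have h : cliffordAct (w.toModel x) (φ.toModel x) = cliffordAct (w'.toModel x) (ψ.toModel x) := by
    rw [show w.toModel x = w'.toModel x from hw, show φ.toModel x = ψ.toModel x from hφ]
  exact h

theorem foldr_rho_apply (l : List (GenField V M)) (φ : SpinorField V M) (x : M) :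
    (l.foldr rho φ) x = (l.map fun w => w.toModel x).foldr cliffordAct (φ.toModel x) := by
  induction l with
  | nil => rfl
  | cons w l ih =>
    rw [List.map_cons, List.foldr_cons, List.foldr_cons, ← ih]
    rfl

theorem memFiltration_two_iff {E : (x : M) → Submodule ℝ (GenTangent V x)}
    [IsManifold 𝓘(ℝ, V) ∞ M] {U : Set M}
    {γ : SpinorField V M} : MemFiltration E U 2 γ ↔ ∀ w₀ ∈ sectionsOn E U, ∀ w₁ ∈ sectionsOn E U,
      ∀ w₂ ∈ sectionsOn E U, ∀ x ∈ U, rho w₀ (rho w₁ (rho w₂ γ)) x = 0 := by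
  constructor
  · intro h w₀ h₀ w₁ h₁ w₂ h₂ x hx
    exact h ![w₀, w₁, w₂] (by intro i; fin_cases i <;> assumption) x hx
  · intro h w hw x hx
    exact h _ (hw 0) _ (hw 1) _ (hw 2) x hx

variable [IsManifold 𝓘(ℝ, V) ∞ M]

theorem SpinorField.SmoothOn.foldr_rho {U : Set M} (hU : IsOpen U) {l : List (GenField V M)}
    (hl : ∀ w ∈ l, w.SmoothOn U) {φ : SpinorField V M} (hφ : φ.SmoothOn U) :
    (l.foldr _root_.rho φ).SmoothOn U := by
  induction l with
  | nil => exact hφ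
  | cons w l ih =>
    exact (ih fun w' hw' => hl w' (List.mem_cons_of_mem _ hw')).rho hU (hl w List.mem_cons_self)

theorem SpinorField.SmoothOn.eventually_ne_zero {φ : SpinorField V M} {U : Set M}
    (hφ : φ.SmoothOn U) (hU : IsOpen U) {x₀ : M} (hx₀ : x₀ ∈ U) (h : φ x₀ ≠ 0) :
    ∀ᶠ x in 𝓝 x₀, φ x ≠ 0 := by
  have hy := extChartAt_self_mem_chartPreimage (V := V) hx₀
  obtain ⟨k, hk⟩ : ∃ k, φ.inChart x₀ (extChartAt 𝓘(ℝ, V) x₀ x₀) k ≠ 0 := by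
    rw [SpinorField.inChart_self]
    exact Function.ne_iff.1 h
  have hc := (hφ.contDiffAt hU hy k).continuousAt.comp (continuousAt_extChartAt (I := 𝓘(ℝ, V)) x₀)
  filter_upwards [hc.eventually_ne hk, (isOpen_extChartAt_source (I := 𝓘(ℝ, V)) x₀).mem_nhds
    (mem_extChartAt_source x₀)] with x hx hxs h0
  refine hx (ContinuousAlternatingMap.ext fun v => ?_)
  rw [Function.comp_apply, SpinorField.inChart_eq_pullback,
    (extChartAt 𝓘(ℝ, V) x₀).left_inv hxs]
  have h0' : φ.toModel x = 0 := h0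
  rw [h0']
  rfl

variable {η : FormField V M 3} {E : (x : M) → Submodule ℝ (GenTangent V x)} {U : Set M}
  {φ : SpinorField V M}

theorem IsPureSpinorOn.rho_eq_zero (h : IsPureSpinorOn E U φ) {x : M} (hx : x ∈ U)
    {w : GenField V M} (hw : w x ∈ E x) : rho w φ x = 0 :=
  (h.nullSpace_eq x hx (w x)).2 hw

theorem IsPureSpinorOn.mono (h : IsPureSpinorOn E U φ) {U' : Set M} (hU : U' ⊆ U) :
    IsPureSpinorOn E U' φ :=
  ⟨h.smooth.mono hU, fun x hx => h.ne_zero x (hU hx), fun x hx => h.nullSpace_eq x (hU hx)⟩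

/-- Every element of `E x₀` extends to a section of `E` near `x₀`. -/
theorem IsAlmostDirac.exists_section (hE : IsAlmostDirac E) (x₀ : M) :
    ∃ U : Set M, IsOpen U ∧ x₀ ∈ U ∧ ∀ u ∈ E x₀, ∃ w ∈ sectionsOn E U, w x₀ = u := by
  obtain ⟨U, hU, hx₀, r, e, he, hfr⟩ := hE.exists_frame x₀
  have hmem (i) : e i ∈ sectionsOn E U := by
    refine ⟨he i, fun x hx => ?_⟩
    rw [← (hfr x hx).2]
    exact Submodule.subset_span ⟨i, rfl⟩
  refine ⟨U, hU, hx₀, fun u hu => ?_⟩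
  rw [← (hfr x₀ hx₀).2] at hu
  induction hu using Submodule.span_induction with
  | mem u hu =>
    obtain ⟨i, rfl⟩ := hu
    exact ⟨e i, hmem i, rfl⟩
  | zero =>
    refine ⟨0, ⟨GenField.smoothOn_of_inChart_self fun x _ => ?_, fun x _ => (E x).zero_mem⟩, rfl⟩
    have h : GenField.inChart (0 : GenField V M) x = fun _ => 0 := by
      funext z
      have := GenField.inChart_smul 0 (0 : GenField V M) x z
      rwa [zero_smul, zero_smul] at this
    rw [h]
    exact contDiffAt_const
  | add u u' _ _ ih ih' =>
    obtain ⟨w, hw, rfl⟩ := ih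
    obtain ⟨w', hw', rfl⟩ := ih'
    exact ⟨w + w', ⟨hw.1.add hU hw'.1, fun x hx => (E x).add_mem (hw.2 x hx) (hw'.2 x hx)⟩, rfl⟩
  | smul c u _ ih =>
    obtain ⟨w, hw, rfl⟩ := ih
    exact ⟨c • w, ⟨hw.1.smul hU c, fun x hx => (E x).smul_mem c (hw.2 x hx)⟩, rfl⟩

variable [FiniteDimensional ℝ V]

theorem twistedD_zero : twistedD η (0 : SpinorField V M) = 0 := by
  have h := SpinorField.SmoothOn.twistedD_add (η := η)
    (SpinorField.smoothOn_zero (V := V) (M := M) Set.univ) (SpinorField.smoothOn_zero Set.univ)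
  rwa [add_zero, left_eq_add] at h

variable [T2Space M]

/-- On a form annihilated by `E`, the bracket of sections of `E` acts as `ρ(w₁) ρ(w₂) (d + η)`. -/
theorem rho_courantBracket_apply (hη : η.SmoothOn Set.univ) (hU : IsOpen U) (hφ : φ.SmoothOn U)
    (hann : ∀ x ∈ U, ∀ w : GenField V M, w x ∈ E x → rho w φ x = 0) {w₁ w₂ : GenField V M}
    (hw₁ : w₁ ∈ sectionsOn E Set.univ) (hw₂ : w₂ ∈ sectionsOn E Set.univ) {x : M} (hx : x ∈ U) :
    rho (courantBracket η w₁ w₂) φ x = rho w₁ (rho w₂ (twistedD η φ)) x := by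
  obtain ⟨χ, hχ, hχ1, hs⟩ := exists_cutoff (V := V) (hU.mem_nhds hx)
  let φ' : SpinorField V M := fun x => χ x • φ x
  have hφ' : φ'.SmoothOn Set.univ := hφ.smul_of_tsupport hU hχ hs
  have h0 {w : GenField V M} (hw : w ∈ sectionsOn E Set.univ) : rho w φ' = 0 := by
    funext z
    have h1 : rho w φ' z = χ z • rho w φ z :=
      map_smul (cliffordEnd (w.toModel z)) (χ z) (φ.toModel z)
    rw [h1]
    by_cases hz : z ∈ U
    · rw [hann z hz w (hw.2 z trivial), smul_zero]
      rfl
    · rw [image_eq_zero_of_notMem_tsupport fun h => hz (hs h), zero_smul]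
      rfl
  have hb := (isCourantBracket_courantBracket hη hw₁.1 hw₂.1).2 φ' hφ'
  simp only [evenCommutator, oddCommutator, h0 hw₁, h0 hw₂, twistedD_zero, rho_zero, add_zero,
    sub_zero] at hb
  obtain ⟨t, ht1, ht, hxt⟩ := eventually_nhds_iff.1 hχ1
  have hφφ' : ∀ z ∈ t, φ' z = φ z := fun z hz => by
    change χ z • φ z = φ z
    rw [ht1 z hz, one_smul]
  have hd : twistedD η φ' x = twistedD η φ x :=
    twistedD_congr (hφ'.mono (Set.subset_univ (t ∩ U))) (hφ.mono Set.inter_subset_right)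
      (ht.inter hU) (fun z hz => hφφ' z hz.1) ⟨hxt, hx⟩
  rw [← rho_congr_apply rfl (hφφ' x hxt), hb]
  exact rho_congr_apply rfl (rho_congr_apply rfl hd)

theorem isCourantIntegrable_of_closed (hη : η.SmoothOn Set.univ)
    (hcl : ∀ w₁ ∈ sectionsOn E Set.univ, ∀ w₂ ∈ sectionsOn E Set.univ,
      courantBracket η w₁ w₂ ∈ sectionsOn E Set.univ) : IsCourantIntegrable E η := by
  intro U hU φ hφ
  refine memFiltration_two_iff.2 fun w₀ h₀ w₁ h₁ w₂ h₂ x hx => ?_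
  obtain ⟨χ, hχ, hχ1, hs⟩ := exists_cutoff (V := V) (hU.mem_nhds hx)
  have hcut {w : GenField V M} (hw : w ∈ sectionsOn E U) :
      (fun z => χ z • w z : GenField V M) ∈ sectionsOn E Set.univ := by
    refine ⟨hw.1.smul_of_tsupport hU hχ hs, fun z _ => ?_⟩
    by_cases hz : z ∈ U
    · exact (E z).smul_mem _ (hw.2 z hz)
    · have : χ z • w z = 0 := by
        rw [image_eq_zero_of_notMem_tsupport fun h => hz (hs h), zero_smul]
      change χ z • w z ∈ E z
      rw [this]
      exact (E z).zero_mem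
  have hval (w : GenField V M) : χ x • w x = w x := by rw [hχ1.self_of_nhds, one_smul]
  have hb := rho_courantBracket_apply hη hU hφ.smooth (fun z hz w hw => hφ.rho_eq_zero hz hw)
    (hcut h₁) (hcut h₂) hx
  rw [hφ.rho_eq_zero hx ((hcl _ (hcut h₁) _ (hcut h₂)).2 x trivial)] at hb
  have hb' : rho w₁ (rho w₂ (twistedD η φ)) x = 0 :=
    (rho_congr_apply (hval w₁).symm (rho_congr_apply (hval w₂).symm rfl)).trans hb.symm
  rw [rho_congr_apply (ψ := 0) rfl hb', rho_zero]
  rfl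

/-- Every almost Dirac structure is locally defined by a pure spinor. -/
theorem IsAlmostDirac.exists_isPureSpinorOn (hE : IsAlmostDirac E) (x₀ : M) :
    ∃ U : Set M, IsOpen U ∧ x₀ ∈ U ∧ ∃ φ : SpinorField V M, IsPureSpinorOn E U φ := by
  obtain ⟨U, hU, hx₀, r, e, he, hfr⟩ := hE.exists_frame x₀
  obtain ⟨s, hs⟩ := exists_foldr_cliffordAct_ne_zero (fun i => (e i).toModel x₀) (hfr x₀ hx₀).1
  obtain ⟨ψ, hψ, rfl⟩ := exists_smooth_inChart_eq (mem_extChartAt_target (I := 𝓘(ℝ, V)) x₀) s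
  let φ : SpinorField V M := (List.ofFn e).foldr rho ψ
  have hφx (x : M) : φ x = (List.ofFn fun i => (e i).toModel x).foldr cliffordAct
      (ψ.toModel x) := by
    have h := foldr_rho_apply (List.ofFn e) ψ x
    rw [List.map_ofFn] at h
    exact h
  have hφ : φ.SmoothOn U := SpinorField.SmoothOn.foldr_rho hU
    (fun w hw => by obtain ⟨i, rfl⟩ := (List.mem_ofFn' _ _).1 hw; exact he i)
    (hψ.mono (Set.subset_univ U))
  have hφ0 : φ x₀ ≠ 0 := by
    rw [hφx, ← SpinorField.inChart_self]
    exact hs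
  obtain ⟨t, ht0, ht, hxt⟩ := eventually_nhds_iff.1 (hφ.eventually_ne_zero hU hx₀ hφ0)
  have hann : ∀ x ∈ U, ∀ w ∈ E x, cliffordAct (V := V) w (φ x) = 0 := by
    intro x hx w hw
    have hspan := (hfr x hx).2
    have hmem (i) : e i x ∈ E x := by
      rw [← hspan]
      exact Submodule.subset_span ⟨i, rfl⟩
    let K : Submodule ℝ (GenTangent V x) :=
      LinearMap.ker ((cliffordEnd (V := V)).flip (φ.toModel x))
    have hle : E x ≤ K := by
      rw [← hspan]
      refine Submodule.span_le.2 ?_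
      rintro _ ⟨i, rfl⟩
      change cliffordAct ((e i).toModel x) (φ.toModel x) = 0
      have h1 : φ.toModel x = _ := hφx x
      rw [h1]
      refine cliffordAct_foldr_eq_zero_of_mem ((List.mem_ofFn' _ _).2 ⟨i, rfl⟩) (fun u hu => ?_) _
      obtain ⟨j, rfl⟩ := (List.mem_ofFn' _ _).1 hu
      exact ((hE.isLagrangian x) _).1 (hmem i) _ (hmem j)
    exact hle hw
  refine ⟨t ∩ U, ht.inter hU, ⟨hxt, hx₀⟩, φ, hφ.mono Set.inter_subset_right,
    fun x hx => ht0 x hx.1, fun x hx w => ⟨fun hw => ?_, hann x hx.2 w⟩⟩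
  refine ((hE.isLagrangian x) w).2 fun w' hw' => ?_
  exact diracPairing_eq_zero_of_cliffordAct_eq_zero (V := V) (ht0 x hx.1) hw (hann x hx.2 w' hw')

theorem IsCourantIntegrable.courantBracket_mem (h : IsCourantIntegrable E η)
    (hη : η.SmoothOn Set.univ) (hE : IsAlmostDirac E) {w₁ w₂ : GenField V M}
    (hw₁ : w₁ ∈ sectionsOn E Set.univ) (hw₂ : w₂ ∈ sectionsOn E Set.univ) :
    courantBracket η w₁ w₂ ∈ sectionsOn E Set.univ := by
  refine ⟨courantBracket_smoothOn hη hw₁.1 hw₂.1, fun x _ => ?_⟩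
  obtain ⟨U₁, hU₁, hx₁, φ, hφ₁⟩ := hE.exists_isPureSpinorOn x
  obtain ⟨U₂, hU₂, hx₂, hext⟩ := hE.exists_section x
  have hU := hU₁.inter hU₂
  have hx : x ∈ U₁ ∩ U₂ := ⟨hx₁, hx₂⟩
  have hφ := hφ₁.mono (Set.inter_subset_left (t := U₂))
  have hres {w : GenField V M} {U' : Set M} (hU' : U₁ ∩ U₂ ⊆ U') (hw : w ∈ sectionsOn E U') :
      w ∈ sectionsOn E (U₁ ∩ U₂) :=
    ⟨hw.1.mono hU', fun z hz => hw.2 z (hU' hz)⟩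
  refine ((hE.isLagrangian x) _).2 fun u hu => ?_
  obtain ⟨w, hw, rfl⟩ := hext u hu
  have h1 := memFiltration_two_iff.1 (h _ hU φ hφ) w (hres Set.inter_subset_right hw) w₁
    (hres (Set.subset_univ _) hw₁) w₂ (hres (Set.subset_univ _) hw₂) x hx
  rw [rho_congr_apply rfl (rho_courantBracket_apply hη hU hφ.smooth
    (fun z hz w hw => hφ.rho_eq_zero hz hw) hw₁ hw₂ hx).symm] at h1
  have h2 := cliffordAct_cliffordAct_add ((courantBracket η w₁ w₂).toModel x) (w.toModel x)
    (φ.toModel x)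
  have h3 : cliffordAct (w.toModel x) (φ.toModel x) = 0 := hφ.rho_eq_zero hx hu
  have h4 : cliffordAct (w.toModel x)
    (cliffordAct ((courantBracket η w₁ w₂).toModel x) (φ.toModel x)) = 0 := h1
  rw [h3, h4, ← cliffordEnd_apply, map_zero, add_zero] at h2
  exact (smul_eq_zero.1 h2.symm).resolve_right (hφ.ne_zero x hx)

end Integrability

theorem mainTheorem10 {V : Type*} [NormedAddCommGroup V] [NormedSpace ℝ V]
    [FiniteDimensional ℝ V] {M : Type*} [TopologicalSpace M] [T2Space M] [ChartedSpace V M]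
    [IsManifold 𝓘(ℝ, V) ∞ M]
    (η : FormField V M 3) (hη : η.SmoothOn Set.univ) (hη_closed : η.extDeriv = 0)
    (E : (x : M) → Submodule ℝ (GenTangent V x)) (hE : IsAlmostDirac E) :
    (∀ w₁ w₂ : GenField V M, w₁.SmoothOn Set.univ → w₂.SmoothOn Set.univ →
      ∃! w : GenField V M, IsCourantBracket η w₁ w₂ w) ∧
    (IsCourantIntegrable E η ↔
      ∀ w₁ ∈ sectionsOn E Set.univ, ∀ w₂ ∈ sectionsOn E Set.univ,
        courantBracket η w₁ w₂ ∈ sectionsOn E Set.univ) ∧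
    (IsCourantIntegrable E η → IsLieAlgebroid E (courantBracket η)) := by
  refine ⟨fun w₁ w₂ hw₁ hw₂ => ?_, ⟨fun h w₁ hw₁ w₂ hw₂ => h.courantBracket_mem hη hE hw₁ hw₂,
    isCourantIntegrable_of_closed hη⟩, fun h => ?_⟩
  · exact ⟨_, isCourantBracket_courantBracket hη hw₁ hw₂, fun w hw =>
      hw.unique hη hw₁ hw₂ (isCourantBracket_courantBracket hη hw₁ hw₂)⟩
  · exact isLieAlgebroid_courantBracket hη hη_closed hE.isLagrangian
      fun w₁ hw₁ w₂ hw₂ => h.courantBracket_mem hη hE hw₁ hw₂
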